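/- **Order-$(n-1)$ fixpoint characterization of termination probabilities.** *Schemes.* Simple types are $\kappa ::= o \mid \kappa_1\to\kappa_2$, with $\mathrm{order}(o)=0$ and $\mathrm{order}(\kappa_1\to\kappa_2)=\max(\mathrm{order}(\kappa_1)+1,\mathrm{order}(\kappa_2))$. Applicative terms $t ::= e \mid \Omega \mid x \mid t_1t_2$ are simply typed, with constants $e,\Omega:o$. A probabilistic higher-order recursion scheme (pHORS) $G=(\mathcal N,\mathcal R,S)$ consists of a finite set of non-terminals $F$ with types $\mathcal N(F)$, one rule $F\,z_1\cdots z_m=t_L\oplus_p t_R$ for each $F:\kappa_1\to\cdots\to\kappa_m\to o$, where $p\in[0,1]$ is rational and $t_L,t_R$ are terms of type $o$ over the non-terminals and the variables $z_i:\kappa_i$, and a start symbol $S$. Its order is the largest order of the types $\mathcal N(F)$. A closed term $F\,t_1\cdots t_m$ of type $o$ rewrites to $[\vec t/\vec z]t_L$ with label $L$ and probability $p$, and to $[\vec t/\vec z]t_R$ with label $R$ and probability $1-p$. For $\pi\in\{L,R\}^*$, $\Pr(G,t,\pi)$ is the product of the probabilities along the rewriting sequence from $t$ to $e$ labelled $\pi$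 if there is one, and $0$ otherwise; $\Pr(G,t)=\sum_{\pi}\Pr(G,t,\pi)$. We assume that $S:o\to o$ and that $e$ does not occur in the rules, and consider $\Pr(G,S\,e)$. *Fixpoint equations.* Types are $\tau::=\mathsf R\mid\tau_1\to\tau_2\mid\tau_1\times\cdots\times\tau_n$. Here $\mathsf R$ is interpreted as $[0,\infty]$ (with $0\cdot\infty=0$), $\tau_1\to\tau_2$ as the $\omega$-continuous functions ordered pointwise, and products componentwise. The order of $\mathsf R$ is $0$, that of a product is the maximum over its components, and that of a function type is as above. A system of equations consists of one equation $f\,(\tilde x_1)\cdots(\tilde x_\ell)=e_f$ for each of finitely many function symbols $f:\tau_1\to\cdots\to\tau_\ell\to\mathsf R$, where the $\tilde x_i$ are tuples of variables of type $\tau_i$, and $e_f:\mathsf R$ is built from constants in $[0,1]$, variables, function symbols, $+$, $\cdot$, application and tupling. Its order is the largest order of the types of its function symbols. A solution assigns to each $f$ an element of the interpretation of its type such that all equations hold for all values of the variables; solutions are ordered pointwise. *Translation.* Write every type as $\kappa_1\to\cdots\to\kappa_r\Rightarrow o^\ell\to o$, meaning $\kappa_1\to\cdots\to\kappa_r\to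 o^\ell\to o$ with $r=0$ or $\kappa_r\neq o$; $\ell$ is its arity. Accordingly write every rule as $F\,y_1\cdots y_r\,x_1\cdots x_k=t_L\oplus_pt_R$, where $x_1,\dots,x_k$ is the maximal postfix of order-0 parameters. Each $y$ of arity $\ell$ gives variables $y_0,\dots,y_{\ell+1}$; put $\tilde y=(y_0,\dots,y_{\ell+1})$ and $\tilde y'=(y_1,\dots,y_{\ell+1})$. Each non-terminal $F$ of arity $k$ gives function symbols $F_0,\dots,F_k$. In the rule of $F$, a term $t$ whose type has arity $\ell$ is translated to a tuple $(t_0,\dots,t_{\ell+k+1})$ by: - $\Omega\mapsto(0^{k+2})$, and $x_i\mapsto(0^i,1,0^{k-i+1})$; - $y\mapsto(y_0,y_1,\dots,y_\ell,(y_{\ell+1})^{k+1})$, and for non-terminals $H\mapsto(H_0,H_1,\dots,H_\ell,(H_0)^{k+1})$; - if $s:\kappa\to\vec\kappa\Rightarrow o^{\ell}\to o$, where $\kappa$ is not among the trailing order-0 arguments of this type, and $\kappa$ has arity $\ell'$, then with $u=(t_1,\dots,t_{\ell'},t_{\ell'+k+1})$ the components of $s\,t$ are $(st)_0=s_0(t_0,u)$;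 $(st)_i=s_i(u)$ for $1\le i\le \ell$; and $(st)_{\ell+i}=s_{\ell+i}(t_{\ell'+i},u)$ for $1\le i\le k+1$; - if $s:o^{\ell+1}\to o$, then $s\,t\mapsto(s_0+s_1\cdot t_0,\;s_2,\dots,s_{\ell+1},\;s_{\ell+2}+s_1\cdot t_1,\dots,s_{\ell+k+2}+s_1\cdot t_{k+1})$. Let $\mathcal E^{\mathrm{ref}}_G$ be the system consisting, for each rule $F\,y_1\cdots y_r\,x_1\cdots x_k=t_L\oplus_pt_R$, of the equations $$F_0\,(\tilde y_1)\cdots(\tilde y_r)=p\,t_{L,0}+(1-p)\,t_{R,0},\qquad F_i\,(\tilde y_1')\cdots(\tilde y_r')=p\,t_{L,i}+(1-p)\,t_{R,i}\quad(1\le i\le k).$$ It is well typed: for $\mathcal N(F)=\kappa_1\to\cdots\to\kappa_r\Rightarrow o^k\to o$, $F_0$ has type $\kappa_1^\dagger\to\cdots\to\kappa_r^\dagger\to\mathsf R$ and $F_1,\dots,F_k$ have type $\kappa_1^{\dagger\prime}\to\cdots\to\kappa_r^{\dagger\prime}\to\mathsf R$. Here, for $\kappa=\sigma_1\to\cdots\to\sigma_q\Rightarrow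 o^\ell\to o$, $A=\sigma_1^\dagger\to\cdots\to\sigma_q^\dagger\to\mathsf R$ and $B=\sigma_1^{\dagger\prime}\to\cdots\to\sigma_q^{\dagger\prime}\to\mathsf R$, we put $\kappa^\dagger=A\times B^\ell\times A$ and $\kappa^{\dagger\prime}=B^\ell\times A$. **Theorem.** Let $n>0$ and let $G=(\mathcal N,\mathcal R,S)$ be a pHORS of order $n$ such that $\mathcal N(S)=o\to o$ and $e$ does not occur in $\mathcal R$. Then $\mathcal E^{\mathrm{ref}}_G$ has order $n-1$, it has a least solution $\rho$, and $$\Pr(G,S\,e)=\rho(S_1).$$ -/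

import Mathlib

open scoped ENNReal
open OmegaCompletePartialOrder

noncomputable section

universe v w

namespace HORS

/-! ## Simple types -/

/-- Simple types over the base type `o`. -/
inductive Ty : Type
  | o : Ty
  | arr (κ σ : Ty) : Ty

namespace Ty

/-- The order of a simple type. -/
def order : Ty → ℕ
  | o => 0
  | arr κ σ => max (order κ + 1) (order σ)

/-- `ground σ` holds iff `σ` has the form `o → ⋯ → o → o`, with any number (possibly `0`) of
arguments. -/
def ground : Ty → Bool
  | o => true
  | arr o σ => ground σ
  | arr (arr _ _) _ => false

end Ty

/-- `Param c τ`: the argument positions of type `τ` of a function of type `c`, that is, the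
indices `i` with `κ_i = τ` when `c = κ_1 → ⋯ → κ_m → o`. -/
inductive Param : Ty → Ty → Type
  | here {κ σ : Ty} : Param (.arr κ σ) κ
  | there {κ σ τ : Ty} (v : Param σ τ) : Param (.arr κ σ) τ

/-- `XVar c`: the positions in the maximal postfix of order-0 arguments of the type `c`. If
`c = κ_1 → ⋯ → κ_k → o^ℓ → o` with `k = 0` or `κ_k ≠ o`, these are the last `ℓ` positions, in
increasing order; `ℓ` is the arity of `c`. -/
inductive XVar : Ty → Type
  | here {σ : Ty} (h : (Ty.arr .o σ).ground = true) : XVar (.arr .o σ)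
  | there {κ σ : Ty} (x : XVar σ) : XVar (.arr κ σ)

/-- `YVar c τ`: the remaining argument positions of type `τ` of the type `c`: those before the
maximal postfix of order-0 arguments (`κ_1, …, κ_k` in the notation above). -/
inductive YVar : Ty → Ty → Type
  | here {κ σ : Ty} (h : (Ty.arr κ σ).ground = false) : YVar (.arr κ σ) κ
  | there {κ σ τ : Ty} (y : YVar σ τ) : YVar (.arr κ σ) τ

/-- An argument position is either in the maximal order-0 postfix (`x`) or before it (`y`). -/
inductive Kind (c : Ty) : Ty → Type
  | y {τ : Ty} (v : YVar c τ) : Kind c τ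
  | x (v : XVar c) : Kind c .o

/-- The classification of an argument position. -/
def Param.kind : {c τ : Ty} → Param c τ → Kind c τ
  | .arr .o σ, _, .here =>
      if h : (Ty.arr .o σ).ground = true then .x (.here h) else .y (.here (by simpa using h))
  | .arr (.arr _ _) _, _, .here => .y (.here rfl)
  | .arr _ _, _, .there v =>
      match v.kind with
      | .y w => .y (.there w)
      | .x w => .x (.there w)

theorem YVar.ground_eq {c τ : Ty} (y : YVar c τ) : c.ground = false := by
  induction y with
  | here h => exact h
  | @there κ σ τ y ih => cases κ <;> simp [Ty.ground, ih]

theorem ground_of_arr {κ σ : Ty} (h : (Ty.arr κ σ).ground = true) : σ.ground = true := by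
  cases κ
  · exact h
  · simp [Ty.ground] at h

instance XVar.instFinite : (σ : Ty) → Finite (XVar σ)
  | .o => Finite.of_injective (β := Empty) (fun x => nomatch x) (fun x => nomatch x)
  | .arr κ σ => by
      have := XVar.instFinite σ
      refine Finite.of_injective (β := Option (XVar σ))
        (fun x => match x with | .here _ => none | .there y => some y) ?_
      intro a b hab
      cases a <;> cases b <;> simp_all

/-! ## Applicative terms and probabilistic higher-order recursion schemes -/

/-- Well-typed applicative terms over non-terminals `F : N F`, whose variables are the formal
parameters of a function of type `c`. In particular `Tm N .o τ` is the type of closed terms. -/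
inductive Tm {ν : Type} (N : ν → Ty) (c : Ty) : Ty → Type
  /-- termination -/
  | e : Tm N c .o
  /-- divergence -/
  | Ω : Tm N c .o
  | var {τ : Ty} (v : Param c τ) : Tm N c τ
  | nt {τ : Ty} (F : ν) (h : N F = τ) : Tm N c τ
  | app {κ σ : Ty} (s : Tm N c (.arr κ σ)) (t : Tm N c κ) : Tm N c σ

/-- The constant `e` does not occur in the term. -/
def Tm.NoE {ν : Type} {N : ν → Ty} {c : Ty} : {τ : Ty} → Tm N c τ → Prop
  | _, .e => False
  | _, .Ω => True
  | _, .var _ => True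
  | _, .nt _ _ => True
  | _, .app s t => s.NoE ∧ t.NoE

/-- Full argument lists (closed terms) for a function of type `c`. -/
def Args {ν : Type} (N : ν → Ty) : Ty → Type
  | .o => Unit
  | .arr κ σ => Tm N .o κ × Args N σ

def Args.get {ν : Type} {N : ν → Ty} : {c τ : Ty} → Args N c → Param c τ → Tm N .o τ
  | .arr _ _, _, a, .here => a.1
  | .arr _ _, _, a, .there v => Args.get a.2 v

/-- The full application `t t_1 ⋯ t_m`. -/
def Tm.apps {ν : Type} {N : ν → Ty} : {σ : Ty} → Tm N .o σ → Args N σ → Tm N .o .o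
  | .o, t, _ => t
  | .arr _ _, t, a => Tm.apps (t.app a.1) a.2

/-- Simultaneous substitution of closed terms for the formal parameters. -/
def Tm.subst {ν : Type} {N : ν → Ty} {c : Ty} (a : Args N c) : {τ : Ty} → Tm N c τ → Tm N .o τ
  | _, .e => .e
  | _, .Ω => .Ω
  | _, .var v => a.get v
  | _, .nt F h => .nt F h
  | _, .app s t => .app (s.subst a) (t.subst a)

/-- A probabilistic higher-order recursion scheme: every non-terminal
`F : κ_1 → ⋯ → κ_m → o` has exactly one rule `F z_1 ⋯ z_m = t_L ⊕_p t_R`. The condition on the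
type of the start symbol is not part of the structure. -/
structure PHORS where
  NT : Type
  finite : Finite NT
  ty : NT → Ty
  p : NT → ℚ
  p_nonneg : ∀ F, 0 ≤ p F
  p_le_one : ∀ F, p F ≤ 1
  tL : ∀ F, Tm ty (ty F) .o
  tR : ∀ F, Tm ty (ty F) .o
  start : NT

namespace PHORS

/-- `G` has order `n`: the maximum of the orders of the types of its non-terminals is `n`. -/
def HasOrder (G : PHORS) (n : ℕ) : Prop :=
  IsGreatest (Set.range fun F : G.NT => (G.ty F).order) n

/-- The constant `e` does not occur in the rules of `G`. -/
def EFree (G : PHORS) : Prop := ∀ F, (G.tL F).NoE ∧ (G.tR F).NoE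

/-- The outcome of a probabilistic choice. -/
inductive Dir : Type
  | L : Dir
  | R : Dir

/-- The labelled rewriting relation on closed terms of type `o`. -/
inductive Step (G : PHORS) : Dir → ℚ → Tm G.ty .o .o → Tm G.ty .o .o → Prop
  | left (F : G.NT) (ts : Args G.ty (G.ty F)) :
      Step G .L (G.p F) ((Tm.nt F rfl).apps ts) ((G.tL F).subst ts)
  | right (F : G.NT) (ts : Args G.ty (G.ty F)) :
      Step G .R (1 - G.p F) ((Tm.nt F rfl).apps ts) ((G.tR F).subst ts)

/-- Relational composition of rewriting steps, multiplying the probabilities. -/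
inductive Steps (G : PHORS) : List Dir → ℚ → Tm G.ty .o .o → Tm G.ty .o .o → Prop
  | nil (t : Tm G.ty .o .o) : Steps G [] 1 t t
  | cons {d : Dir} {p q : ℚ} {π : List Dir} {t u v : Tm G.ty .o .o}
      (h : Step G d p t u) (hs : Steps G π q u v) : Steps G (d :: π) (p * q) t v

open Classical in
/-- The probability that `t` reduces to `e` along the sequence of choices `π`: the (unique) `p`
such that `t` reduces to `e` along `π` with probability `p`, and `0` if there is none. -/
def pathProb (G : PHORS) (t : Tm G.ty .o .o) (π : List Dir) : ℝ≥0∞ :=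
  if h : ∃ p : ℚ, Steps G π p t .e then ENNReal.ofReal (h.choose : ℝ) else 0

/-- The termination probability of `t`. -/
def prob (G : PHORS) (t : Tm G.ty .o .o) : ℝ≥0∞ := ∑' π : List Dir, G.pathProb t π

end PHORS

/-! ## Higher-order fixpoint equations -/

/-- Types of expressions: reals, functions, and finite products `∏_{i ∈ ι} f i`. -/
inductive RTy : Type 1
  | real : RTy
  | arr (a b : RTy) : RTy
  | prod (ι : Type) (fin : Finite ι) (f : ι → RTy) : RTy

/-- The order of a type; the order of a product is the maximum of the orders of its components. -/
def RTy.order : RTy → ℕ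
  | .real => 0
  | .arr a b => max (order a + 1) (order b)
  | .prod _ _ f => ⨆ i, order (f i)

/-- The interpretation of types as ω-cpos: `[0, ∞]`, the ω-continuous functions with the pointwise
order, and products with the componentwise order. -/
def dom : RTy → ωCPO.{0}
  | .real => ωCPO.of ℝ≥0∞
  | .arr a b => ωCPO.of (dom a →𝒄 dom b)
  | .prod ι _ f => ωCPO.of (∀ i : ι, dom (f i))

/-- The underlying set of the interpretation of a type. -/
abbrev Sem (τ : RTy) : Type := (dom τ).carrier

/-- Application of a value of function type. -/
def Sem.app {a b : RTy} (g : Sem (.arr a b)) (x : Sem a) : Sem b :=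
  (show dom a →𝒄 dom b from g) x

/-- Well-typed expressions over typed function symbols `Fn` and typed variables `V`. -/
inductive Expr (Fn : RTy → Type) (V : RTy → Type v) : RTy → Type (max 1 v)
  | const (r : Set.Icc (0 : ℝ) 1) : Expr Fn V .real
  | var {τ : RTy} (x : V τ) : Expr Fn V τ
  | fn {τ : RTy} (f : Fn τ) : Expr Fn V τ
  | add (e₁ e₂ : Expr Fn V .real) : Expr Fn V .real
  | mul (e₁ e₂ : Expr Fn V .real) : Expr Fn V .real
  | app {a b : RTy} (e₁ : Expr Fn V (.arr a b)) (e₂ : Expr Fn V a) : Expr Fn V b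
  | tuple {ι : Type} {fin : Finite ι} {f : ι → RTy} (es : ∀ i, Expr Fn V (f i)) :
      Expr Fn V (.prod ι fin f)

namespace Expr

/-- Renaming of variables. -/
def rename {Fn : RTy → Type} {V : RTy → Type v} {W : RTy → Type w} (r : ∀ τ, V τ → W τ) :
    {τ : RTy} → Expr Fn V τ → Expr Fn W τ
  | _, .const c => .const c
  | _, .var x => .var (r _ x)
  | _, .fn f => .fn f
  | _, .add e₁ e₂ => .add (e₁.rename r) (e₂.rename r)
  | _, .mul e₁ e₂ => .mul (e₁.rename r) (e₂.rename r)
  | _, .app e₁ e₂ => .app (e₁.rename r) (e₂.rename r)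
  | _, .tuple es => .tuple fun i => (es i).rename r

/-- Transport along an equality of types. -/
def cast {Fn : RTy → Type} {V : RTy → Type v} {τ τ' : RTy} (h : τ = τ') (e : Expr Fn V τ) :
    Expr Fn V τ' := h ▸ e

/-- The value of an expression under an interpretation `ρ` of the function symbols and a
valuation `η` of the variables. -/
def eval {Fn : RTy → Type} {V : RTy → Type v} (ρ : ∀ τ, Fn τ → Sem τ) (η : ∀ τ, V τ → Sem τ) :
    {τ : RTy} → Expr Fn V τ → Sem τ
  | _, .const r => ENNReal.ofReal (r : ℝ)
  | _, .var x => η _ x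
  | _, .fn f => ρ _ f
  | _, .add e₁ e₂ => (show ℝ≥0∞ from e₁.eval ρ η) + (show ℝ≥0∞ from e₂.eval ρ η)
  | _, .mul e₁ e₂ => (show ℝ≥0∞ from e₁.eval ρ η) * (show ℝ≥0∞ from e₂.eval ρ η)
  | _, .app e₁ e₂ => Sem.app (e₁.eval ρ η) (e₂.eval ρ η)
  | _, .tuple es => fun i => (es i).eval ρ η

/-- The constant `0`. -/
def zero {Fn : RTy → Type} {V : RTy → Type v} : Expr Fn V .real := .const ⟨0, by simp⟩

/-- The constant `1`. -/
def one {Fn : RTy → Type} {V : RTy → Type v} : Expr Fn V .real := .const ⟨1, by simp⟩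

end Expr

/-- `PVar τ σ`: the variables of type `σ` bound by the left-hand side `f (x̃_1) ⋯ (x̃_ℓ)` of an
equation for a function symbol `f` of type `τ = τ_1 → ⋯ → τ_ℓ → real`, one for each component of
each of the argument tuples `x̃_j : τ_j`. -/
inductive PVar : RTy → RTy → Type 1
  | here {ι : Type} {fin : Finite ι} {f : ι → RTy} {τ : RTy} (i : ι) :
      PVar (.arr (.prod ι fin f) τ) (f i)
  | there {a τ σ : RTy} (z : PVar τ σ) : PVar (.arr a τ) σ

/-- The values `(ỹ_1, …, ỹ_ℓ)` of the argument tuples of a function of type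
`τ_1 → ⋯ → τ_ℓ → real`. -/
def ArgVals : RTy → Type
  | .real => Unit
  | .arr a τ => Sem a × ArgVals τ
  | .prod _ _ _ => Unit

/-- The value of a variable, given the values of the argument tuples. -/
def PVar.get : {τ σ : RTy} → PVar τ σ → ArgVals τ → Sem σ
  | _, _, @PVar.here _ _ f _ i, xs => (show ∀ i, Sem (f i) from xs.1) i
  | _, _, .there z, xs => z.get xs.2

/-- `Holds τ g b`: the equation `g (x̃_1) ⋯ (x̃_ℓ) = b` holds for all values of the argument tuples,
where `g` is a value of type `τ = τ_1 → ⋯ → τ_ℓ → real` and `b` is given as a function of the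
values of `x̃_1, …, x̃_ℓ`. (Function symbols with values in a product are not allowed.) -/
def Holds : (τ : RTy) → Sem τ → (ArgVals τ → ℝ≥0∞) → Prop
  | .real, g, b => (show ℝ≥0∞ from g) = b ()
  | .arr a τ, g, b => ∀ x : Sem a, Holds τ (Sem.app g x) fun xs => b (x, xs)
  | .prod _ _ _, _, _ => False

/-- A finite system of fixpoint equations, with one equation `f (x̃_1) ⋯ (x̃_ℓ) = body f` for each
function symbol `f` (of type `τ = τ_1 → ⋯ → τ_ℓ → real`). -/
structure EqSystem where
  Fn : RTy → Type
  finite : Finite (Σ τ, Fn τ)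
  body : ∀ {τ : RTy}, Fn τ → Expr Fn (PVar τ) .real

namespace EqSystem

/-- The order of a system is the largest order of the types of its function symbols. -/
def HasOrder (E : EqSystem) (n : ℕ) : Prop :=
  IsGreatest {m | ∃ τ, Nonempty (E.Fn τ) ∧ τ.order = m} n

/-- `ρ` satisfies all equations of the system. -/
def IsSolution (E : EqSystem) (ρ : ∀ τ, E.Fn τ → Sem τ) : Prop :=
  ∀ (τ : RTy) (f : E.Fn τ), Holds τ (ρ τ f) fun xs => (E.body f).eval ρ fun _ z => z.get xs

/-- `ρ` is the least solution of the system. -/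
def IsLeastSolution (E : EqSystem) (ρ : ∀ τ, E.Fn τ → Sem τ) : Prop :=
  IsLeast {ρ | E.IsSolution ρ} ρ

end EqSystem

/-! ## The translation of types -/

/-- Expressions that may refer to the current target (`full`), or not (`prime`). -/
inductive Mode : Type
  | full : Mode
  | prime : Mode

/-- The positions of the tuples `(y_0, y_1, …, y_ℓ, y_{ℓ+1})` (mode `full`) and
`(y_1, …, y_ℓ, y_{ℓ+1})` (mode `prime`), where `ι` stands for `{1, …, ℓ}`: `cur` is the position
`0` (the current target), `fresh` is the position `ℓ + 1` (a fresh target). -/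
inductive Slot (ι : Type) : Mode → Type
  | cur : Slot ι .full
  | arg {m : Mode} (i : ι) : Slot ι m
  | fresh {m : Mode} : Slot ι m

instance Slot.instFinite (ι : Type) [Finite ι] (m : Mode) : Finite (Slot ι m) := by
  refine Finite.of_injective (β := Option (Option ι))
    (fun s => match s with | .cur => none | .arg i => some (some i) | .fresh => some none) ?_
  intro a b hab
  cases a <;> cases b <;> simp_all

/-- The types of the components: `A` for the positions `0` and `ℓ + 1`, `B` for `1, …, ℓ`. -/
def Slot.ty {ι : Type} (A B : RTy) : {m : Mode} → Slot ι m → RTy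
  | _, .cur => A
  | _, .arg _ => B
  | _, .fresh => A

/-- For `σ = κ_1 → ⋯ → κ_k → o^ℓ → o` (with `o^ℓ` the maximal order-0 postfix), `comp σ full` is
`κ_1† → ⋯ → κ_k† → real` and `comp σ prime` is `κ_1†' → ⋯ → κ_k†' → real`, where
`κ† = A × B^ℓ × A` and `κ†' = B^ℓ × A` with `A = comp κ full`, `B = comp κ prime` and
`ℓ` the arity of `κ`. -/
def comp : Ty → Mode → RTy
  | .o, _ => .real
  | .arr κ σ, m =>
      bif (Ty.arr κ σ).ground then .real
      else .arr (.prod (Slot (XVar κ) m) inferInstance (Slot.ty (comp κ .full) (comp κ .prime)))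
        (comp σ m)

/-- The types `κ†` (mode `full`) and `κ†'` (mode `prime`). -/
abbrev dag (κ : Ty) (m : Mode) : RTy :=
  .prod (Slot (XVar κ) m) inferInstance (Slot.ty (comp κ .full) (comp κ .prime))

theorem comp_ground {σ : Ty} (h : σ.ground = true) (m : Mode) : comp σ m = .real := by
  cases σ <;> simp [comp, h]

theorem comp_arr {κ σ : Ty} (h : (Ty.arr κ σ).ground = false) (m : Mode) :
    comp (.arr κ σ) m = .arr (dag κ m) (comp σ m) := by
  simp [comp, h]

/-! ## The translation of terms and rules -/

/-- The function symbols of the equations: `F_0` (`cur F`) and `F_1, …, F_ℓ` (`arg F i`), for each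
non-terminal `F` of arity `ℓ`. -/
inductive FSym {ν : Type} (N : ν → Ty) : RTy → Type
  | cur (F : ν) {σ : Ty} (h : N F = σ) : FSym N (comp σ .full)
  | arg (F : ν) {σ : Ty} (h : N F = σ) (i : XVar σ) : FSym N (comp σ .prime)

theorem FSym.finite {ν : Type} [Finite ν] (N : ν → Ty) : Finite (Σ τ, FSym N τ) := by
  refine Finite.of_surjective (α := Σ F : ν, Option (XVar (N F)))
    (fun a => match a with
      | ⟨F, none⟩ => ⟨_, .cur F rfl⟩
      | ⟨F, some i⟩ => ⟨_, .arg F rfl i⟩) ?_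
  rintro ⟨_, f⟩
  cases f with
  | cur F h => subst h; exact ⟨⟨F, none⟩, rfl⟩
  | arg F h i => subst h; exact ⟨⟨F, some i⟩, rfl⟩

/-- The component variables `y_{i,j}` of the parameters `y_i` of a function of type `c`; in mode
`prime`, without the variables `y_{i,0}`. -/
inductive TVar (c : Ty) (m : Mode) : RTy → Type
  | mk {κ : Ty} (y : YVar c κ) (j : Slot (XVar κ) m) :
      TVar c m (Slot.ty (comp κ .full) (comp κ .prime) j)

/-- Inclusion of the variables of mode `prime` into those of mode `full`. -/
def TVar.incl {c : Ty} : ∀ τ, TVar c .prime τ → TVar c .full τ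
  | _, .mk y (.arg i) => .mk y (.arg i)
  | _, .mk y .fresh => .mk y .fresh

/-- The variable `y_{i,j}` as a variable bound by the left-hand side `F_0 (ỹ_1) ⋯ (ỹ_k)` (mode
`full`) or `F_j (ỹ_1') ⋯ (ỹ_k')` (mode `prime`). -/
def YVar.bound {κ : Ty} {m : Mode} (j : Slot (XVar κ) m) : {c : Ty} → YVar c κ →
    PVar (comp c m) (Slot.ty (comp κ .full) (comp κ .prime) j)
  | _, .here h => (comp_arr h m).symm ▸ PVar.here j
  | _, .there y => (comp_arr (YVar.there y).ground_eq m).symm ▸ PVar.there (y.bound j)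

def TVar.bound {c : Ty} {m : Mode} : ∀ τ, TVar c m τ → PVar (comp c m) τ
  | _, .mk y j => y.bound j

/-- Expressions over the function symbols `F_j` and the variables `y_{i,j}`. -/
abbrev TExpr {ν : Type} (N : ν → Ty) (c : Ty) (m : Mode) (τ : RTy) : Type 1 :=
  Expr (FSym N) (TVar c m) τ

/-- Every expression over `ỹ_1', …, ỹ_k'` is one over `ỹ_1, …, ỹ_k`. -/
def TExpr.incl {ν : Type} {N : ν → Ty} {c : Ty} {τ : RTy} (e : TExpr N c .prime τ) :
    TExpr N c .full τ := Expr.rename TVar.incl e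

/-- The tuple `(a, (b_i)_i, d)`. -/
def tupleFull {ν : Type} {N : ν → Ty} {c κ : Ty} {m : Mode} (a : TExpr N c m (comp κ .full))
    (b : XVar κ → TExpr N c m (comp κ .prime)) (d : TExpr N c m (comp κ .full)) :
    TExpr N c m (dag κ .full) :=
  .tuple fun j => match j with
    | .cur => a
    | .arg i => b i
    | .fresh => d

/-- The tuple `((b_i)_i, d)`. -/
def tuplePrime {ν : Type} {N : ν → Ty} {c κ : Ty} {m : Mode}
    (b : XVar κ → TExpr N c m (comp κ .prime)) (d : TExpr N c m (comp κ .full)) :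
    TExpr N c m (dag κ .prime) :=
  .tuple fun j => match j with
    | .arg i => b i
    | .fresh => d

/-- The output `(e_0, e_1, …, e_ℓ, e_{ℓ+1}, …, e_{ℓ+k}, e_{ℓ+k+1})` of the translation of a term of
type `σ` and arity `ℓ`, in the body of a rule for a function of type `c` whose trailing order-0
parameters are `x_1, …, x_k`. All components but `e_0` do not contain variables `y_{i,0}`. -/
structure Out {ν : Type} (N : ν → Ty) (c σ : Ty) where
  /-- `e_0` -/
  cur : TExpr N c .full (comp σ .full)
  /-- `e_1, …, e_ℓ` -/
  arg : XVar σ → TExpr N c .prime (comp σ .prime)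
  /-- `e_{ℓ+1}, …, e_{ℓ+k}` -/
  loc : XVar c → TExpr N c .prime (comp σ .full)
  /-- `e_{ℓ+k+1}` -/
  fresh : TExpr N c .prime (comp σ .full)

namespace Out

/-- The output for `Ω`. -/
def omega {ν : Type} {N : ν → Ty} {c : Ty} : Out N c .o where
  cur := .zero
  arg _ := .zero
  loc _ := .zero
  fresh := .zero

open Classical in
/-- The output for the variable `x_i`. -/
def gvar {ν : Type} {N : ν → Ty} {c : Ty} (x : XVar c) : Out N c .o where
  cur := .zero
  arg _ := .zero
  loc x' := if x' = x then .one else .zero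
  fresh := .zero

/-- The output for a variable `y`: `(y_0, y_1, …, y_ℓ, y_{ℓ+1}, …, y_{ℓ+1})`. -/
def yvar {ν : Type} {N : ν → Ty} {c σ : Ty} (y : YVar c σ) : Out N c σ where
  cur := .var (.mk y .cur)
  arg i := .var (.mk y (.arg i))
  loc _ := .var (.mk y .fresh)
  fresh := .var (.mk y .fresh)

/-- The output for a variable. -/
def ofKind {ν : Type} {N : ν → Ty} {c : Ty} : {σ : Ty} → Kind c σ → Out N c σ
  | _, .y v => yvar v
  | _, .x v => gvar v

/-- The output for a non-terminal `F`: `(F_0, F_1, …, F_ℓ, F_0, …, F_0)`. -/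
def nt {ν : Type} {N : ν → Ty} {c σ : Ty} (F : ν) (h : N F = σ) : Out N c σ where
  cur := .fn (.cur F h)
  arg i := .fn (.arg F h i)
  loc _ := .fn (.cur F h)
  fresh := .fn (.cur F h)

/-- The output for an application `s t`, where `t` does not belong to the trailing order-0
arguments of `s`. -/
def app {ν : Type} {N : ν → Ty} {c κ σ : Ty} (h : (Ty.arr κ σ).ground = false)
    (s : Out N c (.arr κ σ)) (t : Out N c κ) : Out N c σ where
  cur := .app (s.cur.cast (comp_arr h .full))
    (tupleFull t.cur (fun i => TExpr.incl (t.arg i)) (TExpr.incl t.fresh))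
  arg i := .app ((s.arg (.there i)).cast (comp_arr h .prime)) (tuplePrime t.arg t.fresh)
  loc x := .app ((s.loc x).cast (comp_arr h .full)) (tupleFull (t.loc x) t.arg t.fresh)
  fresh := .app (s.fresh.cast (comp_arr h .full)) (tupleFull t.fresh t.arg t.fresh)

/-- The output for an application `s t` where `s` has a type `o^{ℓ+1} → o`:
`(s_0 + s_1 · t_0, s_2, …, s_{ℓ+1}, s_{ℓ+2} + s_1 · t_1, …, s_{ℓ+k+2} + s_1 · t_{k+1})`. -/
def appG {ν : Type} {N : ν → Ty} {c : Ty} : {κ σ : Ty} → (h : (Ty.arr κ σ).ground = true) →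
    (s : Out N c (.arr κ σ)) → (t : Out N c κ) → Out N c σ
  | .o, σ, h, s, t =>
      let s₁ : TExpr N c .prime .real := (s.arg (.here h)).cast (comp_ground h .prime)
      have hσ : ∀ m, .real = comp σ m := fun m => (comp_ground (ground_of_arr h) m).symm
      { cur := (Expr.add (s.cur.cast (comp_ground h .full)) (.mul s₁.incl t.cur)).cast (hσ .full)
        arg := fun i =>
          (s.arg (.there i)).cast ((comp_ground h .prime).trans (hσ .prime))
        loc := fun x =>
          (Expr.add ((s.loc x).cast (comp_ground h .full)) (.mul s₁ (t.loc x))).cast (hσ .full)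
        fresh :=
          (Expr.add (s.fresh.cast (comp_ground h .full)) (.mul s₁ t.fresh)).cast (hσ .full) }
  | .arr _ _, _, h, _, _ => absurd h (by simp [Ty.ground])

end Out

/-- The translation of the terms that do not contain `e`, in the body of a rule for a function of
type `c`. -/
def Tm.tr {ν : Type} {N : ν → Ty} {c : Ty} : {σ : Ty} → (t : Tm N c σ) → t.NoE → Out N c σ
  | _, .e, h => h.elim
  | _, .Ω, _ => .omega
  | _, .var v, _ => .ofKind v.kind
  | _, .nt F h, _ => .nt F h
  | _, .app (κ := κ) (σ := σ) s t, h =>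
      if hg : (Ty.arr κ σ).ground = true then .appG hg (s.tr h.1) (t.tr h.2)
      else .app (by simpa using hg) (s.tr h.1) (t.tr h.2)

namespace PHORS

/-- The constant `p` of the rule of `F`. -/
def pConst (G : PHORS) (F : G.NT) : Set.Icc (0 : ℝ) 1 :=
  ⟨(G.p F : ℝ), by exact_mod_cast G.p_nonneg F, by exact_mod_cast G.p_le_one F⟩

/-- The expression `p · l + (1 - p) · r`, for the probability `p` of the rule of `F`. -/
def choice (G : PHORS) (F : G.NT) {m : Mode} (l r : TExpr G.ty (G.ty F) m .real) :
    TExpr G.ty (G.ty F) m .real :=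
  .add (.mul (.const (G.pConst F)) l) (.mul (.const (unitInterval.symm (G.pConst F))) r)

/-- The order-`(n-1)` fixpoint equations of a scheme `G` whose rules do not contain `e`: each rule
`F y_1 ⋯ y_m x_1 ⋯ x_k = t_L ⊕_p t_R` yields the equations
`F_0 (ỹ_1) ⋯ (ỹ_m) = p · t_{L,0} + (1 - p) · t_{R,0}` and
`F_i (ỹ_1') ⋯ (ỹ_m') = p · t_{L,i} + (1 - p) · t_{R,i}` for `i = 1, …, k`. -/
def eqs (G : PHORS) (hG : G.EFree) : EqSystem where
  Fn := FSym G.ty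
  finite := haveI := G.finite; FSym.finite G.ty
  body f := match f with
    | .cur F rfl =>
        (G.choice F ((G.tL F).tr (hG F).1).cur ((G.tR F).tr (hG F).2).cur).rename TVar.bound
    | .arg F rfl i =>
        (G.choice F (((G.tL F).tr (hG F).1).loc i) (((G.tR F).tr (hG F).2).loc i)).rename
          TVar.bound

/-- The closed term `S e`, where the start symbol `S` has type `o → o`. -/
def startTerm (G : PHORS) (hS : G.ty G.start = .arr .o .o) : Tm G.ty .o .o :=
  .app (.nt G.start hS) .e

/-- The function symbol `S_1 : real`, where the start symbol `S` has type `o → o`. -/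
def startSym (G : PHORS) (hS : G.ty G.start = .arr .o .o) : FSym G.ty .real :=
  .arg G.start hS (.here rfl)

end PHORS

end HORS

end

open scoped ENNReal
open OmegaCompletePartialOrder

universe v w

noncomputable section

namespace HORS

/-! A call to an order-0 parameter discards the calling context: the whole term becomes that
argument. Hence a run of `F y_1 ⋯ y_r x_1 ⋯ x_k` reaches a target either through the `y_j` without
ever calling an `x_i`, or by calling some `x_i` and continuing as `x_i`. The probability is `F_0 + ∑
F_i · Pr(x_i)`, linear in the order-0 arguments, so these are multiplied in instead of being passed,
which saves one order. Since a higher-order argument may itself reach targets of its caller, it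
carries one component for the current target and one for a fresh target; the latter serves when a
parameter `x_i` of the callee is taken as the target.

To make this precise, closed terms receive countably many targets, and each non-terminal a bound on
its unfolding depth (`CT`); `Ev` assigns to a term its distribution over the targets. A `Val` has
one component for every target, together with the argument and fresh components. The logical
relation `Rel` says at type `o` that the target components form the distribution, at arrow types
that application is respected, and at all types that almost all targets are absent and have the
fresh value. That a distribution exists at all is also a consequence of `Rel`, as in reducibility
arguments.

The core is `rel_nt`: a non-terminal of depth `k` is related to the `k`-th Kleene iterate. In the
inductive step (`ev_inst`) the order-0 arguments of a rule are replaced by distinct fresh targets,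
the body is interpreted compositionally (`rel_inst`), and the arguments are substituted back
(`Ev.tsub`). This yields the linear formula above; `Val.apps_tgt` yields the same formula for
values.

For `S e` the component `S_0` vanishes (`ev_start`), so the `k`-th iterate of `S_1` lies between the
probability of terminating in fewer than `k` steps and the full termination probability. Expressions
are ω-continuous, so the least solution is the supremum of the iterates (`exists_isLeastSolution`),
and the sandwich closes. -/

/-! ## Fully applied values -/

/-- The types `τ_1 → ⋯ → τ_ℓ → real`. -/
def RTy.RealValued : RTy → Prop
  | .real => True
  | .arr _ τ => τ.RealValued
  | .prod _ _ _ => False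

/-- The application of a value of type `τ_1 → ⋯ → τ_ℓ → real` to all its arguments. -/
def Sem.applyAll : (τ : RTy) → Sem τ → ArgVals τ → ℝ≥0∞
  | .real, g, _ => g
  | .arr _ τ, g, xs => Sem.applyAll τ (Sem.app g xs.1) xs.2
  | .prod _ _ _, _, _ => 0

theorem holds_iff {τ : RTy} (hτ : τ.RealValued) (g : Sem τ) (b : ArgVals τ → ℝ≥0∞) :
    Holds τ g b ↔ ∀ xs, Sem.applyAll τ g xs = b xs := by
  induction τ with
  | real => exact ⟨fun h _ => h, fun h => h ()⟩
  | arr a τ _ ih =>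
    exact ⟨fun h xs => (ih hτ _ _).1 (h xs.1) xs.2, fun h x => (ih hτ _ _).2 fun xs => h (x, xs)⟩
  | prod => exact hτ.elim

theorem Sem.le_of_applyAll_le {τ : RTy} (hτ : τ.RealValued) {g g' : Sem τ}
    (h : ∀ xs, Sem.applyAll τ g xs ≤ Sem.applyAll τ g' xs) : g ≤ g' := by
  induction τ with
  | real => exact h ()
  | arr a τ _ ih => exact fun x => ih hτ fun xs => h (x, xs)
  | prod => exact hτ.elim

/-! ### ω-continuity of expressions, and currying. -/

instance ArgVals.instOmegaCompletePartialOrder :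
    (τ : RTy) → OmegaCompletePartialOrder (ArgVals τ)
  | .real => inferInstanceAs (OmegaCompletePartialOrder Unit)
  | .arr a τ =>
    haveI := ArgVals.instOmegaCompletePartialOrder τ
    inferInstanceAs (OmegaCompletePartialOrder (Sem a × ArgVals τ))
  | .prod _ _ _ => inferInstanceAs (OmegaCompletePartialOrder Unit)

theorem PVar.ωScottContinuous_get {τ σ : RTy} (z : PVar τ σ) : ωScottContinuous z.get := by
  induction z with
  | @here ι fin f τ i =>
    have h₁ : ωScottContinuous (Prod.fst : Sem (.prod ι fin f) × ArgVals τ → _) :=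
      Prod.ωScottContinuous_fst
    have h₂ : ωScottContinuous (fun x : ∀ i, Sem (f i) => x i) := ωScottContinuous.apply i
    exact h₂.comp h₁
  | @there a τ σ z ih =>
    exact ih.comp (Prod.ωScottContinuous_snd : ωScottContinuous (Prod.snd : Sem a × ArgVals τ → _))

theorem Sem.ωScottContinuous_app {α : Type*} [OmegaCompletePartialOrder α] {a b : RTy}
    {g : α → Sem (.arr a b)} {x : α → Sem a} (hg : ωScottContinuous g) (hx : ωScottContinuous x) :
    ωScottContinuous fun z => Sem.app (g z) (x z) := by
  have h : ωScottContinuous fun p : (Sem a →𝒄 Sem b) × Sem a => p.1 p.2 :=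
    (ContinuousHom.Prod.apply).ωScottContinuous
  exact h.comp (Prod.ωScottContinuous.prodMk (f := fun z => (show Sem a →𝒄 Sem b from g z)) hg hx)

theorem ωScottContinuous_ennreal_add :
    ωScottContinuous fun p : ℝ≥0∞ × ℝ≥0∞ => p.1 + p.2 := by
  refine ωScottContinuous.of_monotone_map_ωSup ⟨fun p q h => add_le_add h.1 h.2, fun c => ?_⟩
  exact ENNReal.iSup_add_iSup_of_monotone (fun i j h => (c.monotone h).1)
    (fun i j h => (c.monotone h).2)

theorem ωScottContinuous_ennreal_mul :
    ωScottContinuous fun p : ℝ≥0∞ × ℝ≥0∞ => p.1 * p.2 := by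
  refine ωScottContinuous.of_monotone_map_ωSup ⟨fun p q h => mul_le_mul' h.1 h.2, fun c => ?_⟩
  change (⨆ i, (c i).1) * (⨆ i, (c i).2) = ⨆ i, (c i).1 * (c i).2
  rw [ENNReal.iSup_mul]
  simp_rw [ENNReal.mul_iSup]
  -- Along a chain the double supremum is attained on the diagonal, at index `max i j`.
  refine le_antisymm (iSup_le fun i => iSup_le fun j => ?_) (iSup_le fun i => ?_)
  · exact le_iSup_of_le (max i j) (mul_le_mul' (c.monotone (le_max_left i j)).1
      (c.monotone (le_max_right i j)).2)
  · exact le_iSup_of_le i (le_iSup_of_le i le_rfl)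

theorem Expr.ωScottContinuous_eval {Fn : RTy → Type} {V : RTy → Type v} {α : Type*}
    [OmegaCompletePartialOrder α] {ρ : α → ∀ τ, Fn τ → Sem τ} {η : α → ∀ τ, V τ → Sem τ}
    (hρ : ∀ τ f, ωScottContinuous fun x => ρ x τ f) (hη : ∀ τ z, ωScottContinuous fun x => η x τ z)
    {τ : RTy} (e : Expr Fn V τ) : ωScottContinuous fun x => e.eval (ρ x) (η x) := by
  induction e with
  | const r => exact ωScottContinuous.const
  | var x => exact hη _ x
  | fn f => exact hρ _ f
  | add e₁ e₂ ih₁ ih₂ =>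
    exact ωScottContinuous_ennreal_add.comp
      (Prod.ωScottContinuous.prodMk (β := ℝ≥0∞) (γ := ℝ≥0∞) ih₁ ih₂)
  | mul e₁ e₂ ih₁ ih₂ =>
    exact ωScottContinuous_ennreal_mul.comp
      (Prod.ωScottContinuous.prodMk (β := ℝ≥0∞) (γ := ℝ≥0∞) ih₁ ih₂)
  | app e₁ e₂ ih₁ ih₂ => exact Sem.ωScottContinuous_app ih₁ ih₂
  | @tuple ι fin f es ih =>
    exact ωScottContinuous.of_apply₂ (β := fun i => Sem (f i)) ih

/-- Turns the right-hand side of an equation into an element of the function type. With `α` the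
space of assignments it gives the Kleene operator together with its continuity; with `α = Unit` it
gives the least element. -/
theorem exists_curry {τ : RTy} (hτ : τ.RealValued) {α : Type*} [OmegaCompletePartialOrder α]
    (b : α × ArgVals τ → ℝ≥0∞) (hb : ωScottContinuous b) :
    ∃ g : α → Sem τ, ωScottContinuous g ∧ ∀ x xs, Sem.applyAll τ (g x) xs = b (x, xs) := by
  induction τ generalizing α with
  | real =>
    exact ⟨fun x => b (x, ()), hb.comp (Prod.ωScottContinuous.prodMk ωScottContinuous.id
      ωScottContinuous.const), fun _ _ => rfl⟩
  | arr a τ _ ih =>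
    obtain ⟨g, hg, hgb⟩ := ih hτ (α := α × Sem a) (fun p => b (p.1.1, (p.1.2, p.2)))
      (hb.comp (Prod.ωScottContinuous.prodMk
        (Prod.ωScottContinuous_fst.comp Prod.ωScottContinuous_fst)
        (Prod.ωScottContinuous.prodMk (β := Sem a) (γ := ArgVals τ)
          (Prod.ωScottContinuous_snd.comp Prod.ωScottContinuous_fst)
          Prod.ωScottContinuous_snd)))
    have h₁ : ∀ x, ωScottContinuous fun y => g (x, y) := fun x =>
      hg.comp (Prod.ωScottContinuous.prodMk ωScottContinuous.const ωScottContinuous.id)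
    have h₂ : ∀ y, ωScottContinuous fun x => g (x, y) := fun y =>
      hg.comp (Prod.ωScottContinuous.prodMk ωScottContinuous.id ωScottContinuous.const)
    have h₃ : ωScottContinuous fun x => ContinuousHom.ofFun (fun y => g (x, y)) (h₁ x) := by
      refine ωScottContinuous.of_monotone_map_ωSup ⟨fun x x' h y => (h₂ y).monotone h, fun c => ?_⟩
      ext y
      exact (h₂ y).map_ωSup c
    exact ⟨fun x => ContinuousHom.ofFun (fun y => g (x, y)) (h₁ x), h₃,
      fun x xs => hgb (x, xs.1) xs.2⟩
  | prod => exact hτ.elim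

/-! ## Least solutions by Kleene iteration -/

namespace EqSystem

/-- A sequence of approximations of the least solution, starting from `0`. -/
structure Approximates (E : EqSystem) (ρ : ℕ → ∀ τ, E.Fn τ → Sem τ) : Prop where
  zero : ∀ τ f xs, Sem.applyAll τ (ρ 0 τ f) xs = 0
  succ : ∀ k τ f xs, Sem.applyAll τ (ρ (k + 1) τ f) xs =
    (E.body f).eval (ρ k) fun _ z => z.get xs

/-- Kleene's fixpoint theorem for the operator that evaluates all right-hand sides. The iterates are
exported because they are what the unfolding depths are compared with. -/
theorem exists_isLeastSolution (E : EqSystem) (hE : ∀ τ, E.Fn τ → τ.RealValued) :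
    ∃ ρ, E.IsLeastSolution ρ ∧ ∃ ρ' : ℕ → ∀ τ, E.Fn τ → Sem τ, E.Approximates ρ' ∧
      ∀ f : E.Fn .real, ρ .real f = ⨆ k, (show ℝ≥0∞ from ρ' k .real f) := by
  have hbot : ∀ τ, E.Fn τ → ∃ g : Sem τ, ∀ xs, Sem.applyAll τ g xs = 0 := fun τ f => by
    obtain ⟨g, -, hg⟩ := exists_curry (hE τ f) (α := Unit) (fun _ => 0) ωScottContinuous.const
    exact ⟨g (), hg ()⟩
  choose bot hbot using hbot
  have hstep : ∀ τ (f : E.Fn τ), ∃ g : (∀ τ, E.Fn τ → Sem τ) → Sem τ, ωScottContinuous g ∧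
      ∀ ρ xs, Sem.applyAll τ (g ρ) xs = (E.body f).eval ρ fun _ z => z.get xs := fun τ f =>
    exists_curry (hE τ f) (fun p => (E.body f).eval p.1 fun _ z => z.get p.2)
      (Expr.ωScottContinuous_eval (ρ := fun p : (∀ τ, E.Fn τ → Sem τ) × ArgVals τ => p.1)
        (η := fun p σ (z : PVar τ σ) => z.get p.2)
        (fun τ' f' => ((ωScottContinuous.apply (β := fun _ => Sem τ') f').comp
          (ωScottContinuous.apply (β := fun τ => E.Fn τ → Sem τ) τ')).comp
            Prod.ωScottContinuous_fst)
        (fun σ (z : PVar τ σ) => z.ωScottContinuous_get.comp Prod.ωScottContinuous_snd) _)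
  choose step hcont hstep using hstep
  let Φ : (∀ τ, E.Fn τ → Sem τ) →𝒄 (∀ τ, E.Fn τ → Sem τ) :=
    ContinuousHom.ofFun (fun ρ τ f => step τ f ρ)
      (ωScottContinuous.of_apply₂ fun τ => ωScottContinuous.of_apply₂ fun f => hcont τ f)
  have hle : ∀ ρ : ∀ τ, E.Fn τ → Sem τ, bot ≤ ρ := fun ρ τ f =>
    Sem.le_of_applyAll_le (hE τ f) fun xs => by simp [hbot]
  have hsol : ∀ ρ, E.IsSolution ρ ↔ Φ ρ = ρ := by
    intro ρ
    constructor
    · intro h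
      funext τ f
      have := (holds_iff (hE τ f) _ _).1 (h τ f)
      exact le_antisymm
        (Sem.le_of_applyAll_le (hE τ f) fun xs => ((hstep τ f ρ xs).trans (this xs).symm).le)
        (Sem.le_of_applyAll_le (hE τ f) fun xs => ((hstep τ f ρ xs).trans (this xs).symm).ge)
    · intro h τ f
      refine (holds_iff (hE τ f) _ _).2 fun xs => ?_
      conv_lhs => rw [← h]
      exact hstep τ f ρ xs
  let c := fixedPoints.iterateChain (Φ : _ →o _) bot (hle _)
  -- The final `rfl`: suprema of assignments are pointwise, and at type `real` they are suprema in
  -- `[0, ∞]`.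
  refine ⟨ωSup c, ⟨(hsol _).2 (fixedPoints.ωSup_iterate_mem_fixedPoint Φ bot (hle _)), ?_⟩,
    fun k => c k, ⟨fun τ f xs => hbot τ f xs, fun k τ f xs => ?_⟩, fun f => rfl⟩
  · exact fun ρ hρ => fixedPoints.ωSup_iterate_le_fixedPoint Φ bot (hle _) ((hsol ρ).1 hρ) (hle ρ)
  · have : c (k + 1) = Φ (c k) := Function.iterate_succ_apply' _ _ _
    rw [this]
    exact hstep τ f (c k) xs

end EqSystem

/-! ## The order of the translated types -/

theorem comp_realValued (σ : Ty) (m : Mode) : (comp σ m).RealValued := by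
  induction σ with
  | o => trivial
  | arr κ σ _ ih =>
    cases h : (Ty.arr κ σ).ground
    · rw [comp_arr h]; exact ih
    · rw [comp_ground h]; trivial

theorem Ty.order_le_one_of_ground {σ : Ty} (h : σ.ground = true) : σ.order ≤ 1 := by
  induction σ with
  | o => simp [Ty.order]
  | arr κ σ _ ih =>
    cases κ
    · simpa [Ty.order] using ih h
    · simp [Ty.ground] at h

theorem Ty.one_lt_order_of_not_ground {σ : Ty} (h : σ.ground = false) : 1 < σ.order := by
  induction σ with
  | o => simp [Ty.ground] at h
  | arr κ σ _ ih =>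
    cases κ
    · exact lt_max_of_lt_right (ih h)
    · refine lt_max_of_lt_left ?_
      simp [Ty.order]

/-- Ground types are exactly those of order at most 1, and they collapse to `real`; at any other
type every argument loses one order by induction. -/
theorem comp_order (σ : Ty) (m : Mode) : (comp σ m).order = σ.order - 1 := by
  induction σ generalizing m with
  | o => rfl
  | arr κ σ ihκ ihσ =>
    cases h : (Ty.arr κ σ).ground
    · rw [comp_arr h]
      have hslot : ∀ j : Slot (XVar κ) m,
          (Slot.ty (comp κ .full) (comp κ .prime) j).order = κ.order - 1 := by
        intro j
        cases j
        exacts [ihκ _, ihκ _, ihκ _]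
      have hdag : (dag κ m).order = κ.order - 1 := by
        have : Nonempty (Slot (XVar κ) m) := ⟨.fresh⟩
        simp [RTy.order, hslot]
      have h1 := Ty.one_lt_order_of_not_ground h
      -- For `κ = o` the subtraction truncates and the argument contributes 1 instead of 0. This is
      -- harmless, since a type that is not ground has order at least 2.
      have hκ : κ = .o ∨ 1 ≤ κ.order := by
        cases κ <;> simp [Ty.order]
      change max ((dag κ m).order + 1) (comp σ m).order = max (κ.order + 1) σ.order - 1
      change 1 < max (κ.order + 1) σ.order at h1
      rw [hdag, ihσ]
      rcases hκ with rfl | hκ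
      · simp only [Ty.order] at h1 ⊢
        omega
      · omega
    · rw [comp_ground h]
      have := Ty.order_le_one_of_ground h
      simp only [RTy.order]
      omega

theorem FSym.exists_eq_comp {ν : Type} {N : ν → Ty} {τ : RTy} (f : FSym N τ) :
    ∃ F m, τ = comp (N F) m := by
  cases f with
  | cur F h => exact ⟨F, _, by rw [h]⟩
  | arg F h i => exact ⟨F, _, by rw [h]⟩

theorem PHORS.eqs_hasOrder {G : PHORS} (hG : G.EFree) {n : ℕ} (h : G.HasOrder n) :
    (G.eqs hG).HasOrder (n - 1) := by
  obtain ⟨⟨F, hF⟩, hub⟩ := h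
  refine ⟨⟨_, ⟨FSym.cur F rfl⟩, by rw [comp_order]; exact congrArg (· - 1) hF⟩, ?_⟩
  rintro _ ⟨τ, ⟨f⟩, rfl⟩
  obtain ⟨F', m, rfl⟩ := FSym.exists_eq_comp f
  rw [comp_order]
  exact Nat.sub_le_sub_right (hub ⟨F', rfl⟩) 1

/-! ## Termination probabilities -/

section Apps

variable {ν : Type} {N : ν → Ty}

/-- The non-terminal in head position. -/
def Tm.head {c : Ty} : {τ : Ty} → Tm N c τ → Option ν
  | _, .e => none
  | _, .Ω => none
  | _, .var _ => none
  | _, .nt F _ => some F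
  | _, .app s _ => s.head

theorem Tm.head_apps {σ : Ty} (s : Tm N .o σ) (a : Args N σ) : (s.apps a).head = s.head := by
  induction σ with
  | o => rfl
  | arr κ σ _ ih => exact (ih (s.app a.1) a.2).trans rfl

theorem Tm.apps_inj {σ : Ty} {s s' : Tm N .o σ} {a a' : Args N σ} (h : s.apps a = s'.apps a') :
    s = s' ∧ a = a' := by
  induction σ with
  | o => exact ⟨h, rfl⟩
  | arr κ σ _ ih =>
    obtain ⟨h₁, h₂⟩ := ih h
    injection h₁ with _ _ hs ht
    exact ⟨hs, Prod.ext ht h₂⟩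

end Apps

namespace PHORS

variable {G : PHORS}

/-- The contracta of the redex `F t_1 ⋯ t_m`. -/
def contract (G : PHORS) (F : G.NT) (ts : Args G.ty (G.ty F)) : Dir → Tm G.ty .o .o
  | .L => (G.tL F).subst ts
  | .R => (G.tR F).subst ts

/-- The probability of a choice. -/
def dirProb (G : PHORS) (F : G.NT) : Dir → ℚ
  | .L => G.p F
  | .R => 1 - G.p F

theorem dirProb_nonneg (F : G.NT) (d : Dir) : 0 ≤ G.dirProb F d := by
  cases d
  · exact G.p_nonneg F
  · exact sub_nonneg.2 (G.p_le_one F)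

theorem step_iff {d : Dir} {p : ℚ} {t u : Tm G.ty .o .o} :
    G.Step d p t u ↔ ∃ F ts, t = (Tm.nt F rfl).apps ts ∧ p = G.dirProb F d ∧
      u = G.contract F ts d := by
  constructor
  · rintro (⟨F, ts⟩ | ⟨F, ts⟩) <;> exact ⟨F, ts, rfl, rfl, rfl⟩
  · rintro ⟨F, ts, rfl, rfl, rfl⟩
    cases d
    exacts [.left F ts, .right F ts]

/-- Head and arguments can be read off from a redex, so rewriting is deterministic once the choice
is fixed. -/
theorem step_apps_iff {d : Dir} {p : ℚ} {F : G.NT} {ts : Args G.ty (G.ty F)} {u : Tm G.ty .o .o} :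
    G.Step d p ((Tm.nt F rfl).apps ts) u ↔ p = G.dirProb F d ∧ u = G.contract F ts d := by
  rw [step_iff]
  constructor
  · rintro ⟨F', ts', h, rfl, rfl⟩
    have hF : F = F' := by
      have := congrArg Tm.head h
      rw [Tm.head_apps, Tm.head_apps] at this
      exact Option.some.inj this
    subst hF
    obtain ⟨-, rfl⟩ := Tm.apps_inj h
    exact ⟨rfl, rfl⟩
  · rintro ⟨rfl, rfl⟩
    exact ⟨F, ts, rfl, rfl, rfl⟩

theorem not_step_of_head_eq_none {d : Dir} {p : ℚ} {t u : Tm G.ty .o .o} (ht : t.head = none) :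
    ¬ G.Step d p t u := by
  rw [step_iff]
  rintro ⟨F, ts, rfl, -⟩
  rw [Tm.head_apps] at ht
  simp [Tm.head] at ht

theorem steps_cons_iff {d : Dir} {p : ℚ} {π : List Dir} {t v : Tm G.ty .o .o} :
    G.Steps (d :: π) p t v ↔ ∃ q r u, G.Step d q t u ∧ G.Steps π r u v ∧ p = q * r := by
  constructor
  · rintro (_ | ⟨h, hs⟩)
    exact ⟨_, _, _, h, hs, rfl⟩
  · rintro ⟨q, r, u, h, hs, rfl⟩
    exact .cons h hs

theorem steps_nil_iff {p : ℚ} {t v : Tm G.ty .o .o} : G.Steps [] p t v ↔ p = 1 ∧ t = v := by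
  constructor
  · rintro ⟨⟩
    exact ⟨rfl, rfl⟩
  · rintro ⟨rfl, rfl⟩
    exact .nil t

/-- Makes the choice of a witness in `pathProb` immaterial. -/
theorem steps_unique {π : List Dir} {p p' : ℚ} {t v : Tm G.ty .o .o} (h : G.Steps π p t v)
    (h' : G.Steps π p' t v) : p = p' := by
  induction π generalizing p p' t with
  | nil => rw [(steps_nil_iff.1 h).1, (steps_nil_iff.1 h').1]
  | cons d π ih =>
    obtain ⟨q, r, u, hs, hr, rfl⟩ := steps_cons_iff.1 h
    obtain ⟨q', r', u', hs', hr', rfl⟩ := steps_cons_iff.1 h'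
    obtain ⟨F, ts, rfl, rfl, rfl⟩ := step_iff.1 hs
    obtain ⟨rfl, rfl⟩ := step_apps_iff.1 hs'
    rw [ih hr hr']

theorem pathProb_eq_of_steps {π : List Dir} {p : ℚ} {t : Tm G.ty .o .o} (h : G.Steps π p t .e) :
    G.pathProb t π = ENNReal.ofReal (p : ℝ) := by
  have hex : ∃ p : ℚ, G.Steps π p t .e := ⟨p, h⟩
  rw [pathProb, dif_pos hex, steps_unique hex.choose_spec h]

theorem pathProb_eq_zero {π : List Dir} {t : Tm G.ty .o .o} (h : ∀ p, ¬ G.Steps π p t .e) :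
    G.pathProb t π = 0 := by
  rw [pathProb, dif_neg (not_exists.2 h)]

theorem pathProb_e_nil : G.pathProb .e [] = 1 := by
  rw [pathProb_eq_of_steps (.nil _)]
  simp

theorem pathProb_nil_eq_zero {t : Tm G.ty .o .o} (h : t ≠ .e) : G.pathProb t [] = 0 :=
  pathProb_eq_zero fun _ hs => h (steps_nil_iff.1 hs).2

theorem pathProb_cons_eq_zero {d : Dir} {π : List Dir} {t : Tm G.ty .o .o} (h : t.head = none) :
    G.pathProb t (d :: π) = 0 :=
  pathProb_eq_zero fun _ hs => by
    obtain ⟨_, _, _, hs, -⟩ := steps_cons_iff.1 hs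
    exact not_step_of_head_eq_none h hs

theorem apps_ne_e (F : G.NT) (ts : Args G.ty (G.ty F)) : (Tm.nt F rfl).apps ts ≠ .e := by
  intro h
  have := congrArg Tm.head h
  rw [Tm.head_apps] at this
  simp [Tm.head] at this

theorem pathProb_apps_cons (F : G.NT) (ts : Args G.ty (G.ty F)) (d : Dir) (π : List Dir) :
    G.pathProb ((Tm.nt F rfl).apps ts) (d :: π) =
      ENNReal.ofReal (G.dirProb F d : ℝ) * G.pathProb (G.contract F ts d) π := by
  by_cases h : ∃ p, G.Steps π p (G.contract F ts d) .e
  · obtain ⟨p, hp⟩ := h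
    rw [pathProb_eq_of_steps hp,
      pathProb_eq_of_steps (.cons (step_apps_iff.2 ⟨rfl, rfl⟩) hp), Rat.cast_mul,
      ENNReal.ofReal_mul (by exact_mod_cast G.dirProb_nonneg F d)]
  · rw [pathProb_eq_zero (not_exists.1 h), mul_zero]
    refine pathProb_eq_zero fun p hp => h ?_
    obtain ⟨q, r, u, hs, hr, rfl⟩ := steps_cons_iff.1 hp
    obtain ⟨rfl, rfl⟩ := step_apps_iff.1 hs
    exact ⟨r, hr⟩

/-- The decomposition of a sequence of choices into its first element and the remaining ones. -/
def pathEquiv : Unit ⊕ (List Dir ⊕ List Dir) ≃ List Dir where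
  toFun
    | .inl _ => []
    | .inr (.inl π) => .L :: π
    | .inr (.inr π) => .R :: π
  invFun
    | [] => .inl ()
    | .L :: π => .inr (.inl π)
    | .R :: π => .inr (.inr π)
  left_inv x := by rcases x with _ | _ | _ <;> rfl
  right_inv x := by rcases x with _ | ⟨_ | _, _⟩ <;> rfl

theorem tsum_paths (f : List Dir → ℝ≥0∞) :
    ∑' π, f π = f [] + (∑' π, f (.L :: π) + ∑' π, f (.R :: π)) := by
  rw [← pathEquiv.tsum_eq, ENNReal.summable.tsum_sum ENNReal.summable,
    ENNReal.summable.tsum_sum ENNReal.summable, tsum_fintype, Finset.univ_unique,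
    Finset.sum_singleton]
  rfl

/-- The probability that `t` reduces to `e` in fewer than `n` steps. -/
def probLT (G : PHORS) (t : Tm G.ty .o .o) (n : ℕ) : ℝ≥0∞ :=
  ∑' π : List Dir, if π.length < n then G.pathProb t π else 0

theorem prob_e : G.prob .e = 1 := by
  rw [prob, tsum_paths, pathProb_e_nil]
  simp [pathProb_cons_eq_zero (G := G) (t := .e) rfl]

theorem prob_apps (F : G.NT) (ts : Args G.ty (G.ty F)) :
    G.prob ((Tm.nt F rfl).apps ts) =
      ENNReal.ofReal (G.dirProb F .L : ℝ) * G.prob (G.contract F ts .L) +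
      ENNReal.ofReal (G.dirProb F .R : ℝ) * G.prob (G.contract F ts .R) := by
  simp only [prob]
  rw [tsum_paths, pathProb_nil_eq_zero (apps_ne_e F ts), zero_add]
  simp only [pathProb_apps_cons, ENNReal.tsum_mul_left]

/-- The strict length bound matches unfolding depth 0, where the distribution is also 0. -/
theorem probLT_zero (t : Tm G.ty .o .o) : G.probLT t 0 = 0 := by
  simp [probLT]

theorem probLT_apps_succ (F : G.NT) (ts : Args G.ty (G.ty F)) (n : ℕ) :
    G.probLT ((Tm.nt F rfl).apps ts) (n + 1) =
      ENNReal.ofReal (G.dirProb F .L : ℝ) * G.probLT (G.contract F ts .L) n +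
      ENNReal.ofReal (G.dirProb F .R : ℝ) * G.probLT (G.contract F ts .R) n := by
  simp only [probLT]
  rw [tsum_paths, pathProb_nil_eq_zero (apps_ne_e F ts)]
  simp only [pathProb_apps_cons, ← ENNReal.tsum_mul_left, List.length_cons,
    Nat.add_lt_add_iff_right, mul_ite, mul_zero, ite_self, zero_add]

theorem probLT_e_le (n : ℕ) : G.probLT .e n ≤ 1 := by
  rw [← prob_e (G := G)]
  exact ENNReal.tsum_le_tsum fun π => by split_ifs <;> simp

theorem probLT_Ω (n : ℕ) : G.probLT .Ω n = 0 := by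
  refine ENNReal.tsum_eq_zero.2 fun π => ?_
  cases π with
  | nil => simp [pathProb_nil_eq_zero (G := G) (t := .Ω) nofun]
  | cons d π => simp [pathProb_cons_eq_zero (G := G) (t := .Ω) rfl]

theorem prob_le_iSup_probLT (t : Tm G.ty .o .o) : G.prob t ≤ ⨆ n, G.probLT t n := by
  rw [prob, ENNReal.tsum_eq_iSup_sum]
  -- A finite set of paths has bounded length; the `+ 1` makes the bound strict.
  refine iSup_le fun s => le_iSup_of_le (s.sup List.length + 1) ?_
  refine le_trans (Finset.sum_le_sum fun π hπ => ?_) (ENNReal.sum_le_tsum s)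
  rw [if_pos (Nat.lt_succ_of_le (Finset.le_sup (f := List.length) hπ))]

end PHORS

/-! ## Closed terms with targets -/

section Targets

variable {ν : Type} {N : ν → Ty}

/-- Closed terms with countably many targets of type `o`. Every occurrence of a non-terminal carries
a bound on the depth of its unfolding. -/
inductive CT (N : ν → Ty) : Ty → Type
  | Ω : CT N .o
  | tgt (a : ℕ) : CT N .o
  | nt {τ : Ty} (F : ν) (k : ℕ) (h : N F = τ) : CT N τ
  | app {κ σ : Ty} (s : CT N (.arr κ σ)) (t : CT N κ) : CT N σ

namespace CT

/-- The application to a full list of arguments. -/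
def apps : {σ : Ty} → CT N σ → (∀ τ, Param σ τ → CT N τ) → CT N .o
  | .o, t, _ => t
  | .arr _ _, t, a => apps (t.app (a _ .here)) fun _ v => a _ (.there v)

/-- All targets in the term are smaller than `M`. -/
def Below (M : ℕ) : {τ : Ty} → CT N τ → Prop
  | _, .Ω => True
  | _, .tgt a => a < M
  | _, .nt _ _ _ => True
  | _, .app s t => s.Below M ∧ t.Below M

/-- All bounds on unfolding depths in the term are at least `n`. -/
def DepthGE (n : ℕ) : {τ : Ty} → CT N τ → Prop
  | _, .Ω => True
  | _, .tgt _ => True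
  | _, .nt _ k _ => n ≤ k
  | _, .app s t => s.DepthGE n ∧ t.DepthGE n

/-- Substitution for the targets. -/
def tsub (θ : ℕ → CT N .o) : {τ : Ty} → CT N τ → CT N τ
  | _, .Ω => .Ω
  | _, .tgt a => θ a
  | _, .nt F k h => .nt F k h
  | _, .app s t => .app (s.tsub θ) (t.tsub θ)

/-- The underlying closed term, where `0` is the target `e` and all other targets diverge. -/
def erase : {τ : Ty} → CT N τ → Tm N .o τ
  | _, .Ω => .Ω
  | _, .tgt a => if a = 0 then .e else .Ω
  | _, .nt F _ h => .nt F h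
  | _, .app s t => .app s.erase t.erase

end CT

/-- The instance of the body of a rule where the formal parameters are replaced by closed terms, and
non-terminals may be unfolded to depth `k`. -/
def Tm.inst {c : Ty} (k : ℕ) (a : ∀ τ, Param c τ → CT N τ) : {τ : Ty} → Tm N c τ → CT N τ
  | _, .e => .tgt 0
  | _, .Ω => .Ω
  | _, .var v => a _ v
  | _, .nt F h => .nt F k h
  | _, .app s t => .app (s.inst k a) (t.inst k a)

theorem forall_param_arr {κ σ : Ty} {P : ∀ τ, Param (.arr κ σ) τ → Prop} :
    (∀ τ v, P τ v) ↔ P κ .here ∧ ∀ τ v, P τ (.there v) := by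
  refine ⟨fun h => ⟨h _ _, fun τ v => h _ _⟩, fun h τ v => ?_⟩
  cases v
  exacts [h.1, h.2 _ _]

namespace CT

theorem Below.mono {M M' : ℕ} (h : M ≤ M') {τ : Ty} {t : CT N τ} (ht : t.Below M) :
    t.Below M' := by
  induction t with
  | Ω => trivial
  | tgt a => exact lt_of_lt_of_le ht h
  | nt => trivial
  | app s t ihs iht => exact ⟨ihs ht.1, iht ht.2⟩

theorem DepthGE.mono {n n' : ℕ} (h : n' ≤ n) {τ : Ty} {t : CT N τ} (ht : t.DepthGE n) :
    t.DepthGE n' := by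
  induction t with
  | Ω => trivial
  | tgt a => trivial
  | nt => exact h.trans ht
  | app s t ihs iht => exact ⟨ihs ht.1, iht ht.2⟩

theorem below_apps {M : ℕ} {σ : Ty} {s : CT N σ} {a : ∀ τ, Param σ τ → CT N τ} :
    (s.apps a).Below M ↔ s.Below M ∧ ∀ τ v, (a τ v).Below M := by
  induction σ with
  | o => exact ⟨fun h => ⟨h, nofun⟩, fun h => h.1⟩
  | arr κ σ _ ih =>
    rw [forall_param_arr (P := fun τ v => (a τ v).Below M), apps, ih]
    exact and_assoc

theorem depthGE_apps {n : ℕ} {σ : Ty} {s : CT N σ} {a : ∀ τ, Param σ τ → CT N τ} :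
    (s.apps a).DepthGE n ↔ s.DepthGE n ∧ ∀ τ v, (a τ v).DepthGE n := by
  induction σ with
  | o => exact ⟨fun h => ⟨h, nofun⟩, fun h => h.1⟩
  | arr κ σ _ ih =>
    rw [forall_param_arr (P := fun τ v => (a τ v).DepthGE n), apps, ih]
    exact and_assoc

theorem tsub_apps (θ : ℕ → CT N .o) {σ : Ty} (s : CT N σ) (a : ∀ τ, Param σ τ → CT N τ) :
    (s.apps a).tsub θ = (s.tsub θ).apps fun τ v => (a τ v).tsub θ := by
  induction σ with
  | o => rfl
  | arr κ σ _ ih => rw [apps, ih]; rfl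

theorem tsub_eq_self {M : ℕ} {θ : ℕ → CT N .o} (hθ : ∀ a < M, θ a = .tgt a) {τ : Ty} {t : CT N τ}
    (ht : t.Below M) : t.tsub θ = t := by
  induction t with
  | Ω => rfl
  | tgt a => exact hθ a ht
  | nt => rfl
  | app s t ihs iht => rw [tsub, ihs ht.1, iht ht.2]

end CT

/-- An occurrence of `e` would become target `0` and be affected by `θ`; without it, all targets
come from the arguments. -/
theorem Tm.tsub_inst {c : Ty} (θ : ℕ → CT N .o) (k : ℕ) (a : ∀ τ, Param c τ → CT N τ) {τ : Ty}
    {t : Tm N c τ} (ht : t.NoE) :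
    (t.inst k a).tsub θ = t.inst k fun τ v => (a τ v).tsub θ := by
  induction t with
  | e => exact ht.elim
  | app s t ihs iht => rw [inst, CT.tsub, ihs ht.1, iht ht.2]; rfl
  | _ => rfl

theorem Tm.below_inst {c : Ty} {M k : ℕ} {a : ∀ τ, Param c τ → CT N τ}
    (ha : ∀ τ v, (a τ v).Below M) {τ : Ty} {t : Tm N c τ} (ht : t.NoE) : (t.inst k a).Below M := by
  induction t with
  | e => exact ht.elim
  | var v => exact ha _ v
  | app s t ihs iht => exact ⟨ihs ht.1, iht ht.2⟩
  | _ => trivial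

theorem Tm.depthGE_inst {c : Ty} {n k : ℕ} (hk : n ≤ k) {a : ∀ τ, Param c τ → CT N τ}
    (ha : ∀ τ v, (a τ v).DepthGE n) {τ : Ty} (t : Tm N c τ) : (t.inst k a).DepthGE n := by
  induction t with
  | var v => exact ha _ v
  | nt => exact hk
  | app s t ihs iht => exact ⟨ihs, iht⟩
  | _ => trivial

/-- The list of arguments given by a family of closed terms. -/
def Args.ofFun : {σ : Ty} → (∀ τ, Param σ τ → Tm N .o τ) → Args N σ
  | .o, _ => ()
  | .arr _ _, a => (a _ .here, Args.ofFun fun _ v => a _ (.there v))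

theorem Args.get_ofFun {σ τ : Ty} (a : ∀ τ, Param σ τ → Tm N .o τ) (v : Param σ τ) :
    (Args.ofFun a).get v = a τ v := by
  induction v with
  | here => rfl
  | there v ih => exact ih fun _ v => a _ (.there v)

theorem CT.erase_apps {σ : Ty} (s : CT N σ) (a : ∀ τ, Param σ τ → CT N τ) :
    (s.apps a).erase = s.erase.apps (Args.ofFun fun τ v => (a τ v).erase) := by
  induction σ with
  | o => rfl
  | arr κ σ _ ih => rw [apps, ih]; rfl

theorem Tm.erase_inst {c : Ty} (k : ℕ) (a : ∀ τ, Param c τ → CT N τ) {τ : Ty} (t : Tm N c τ) :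
    (t.inst k a).erase = t.subst (Args.ofFun fun τ v => (a τ v).erase) := by
  induction t with
  | e => rfl
  | var v => exact (Args.get_ofFun (fun τ v => (a τ v).erase) v).symm
  | app s t ihs iht => rw [inst, CT.erase, ihs, iht]; rfl
  | _ => rfl

end Targets

/-! ## Evaluation of terms to distributions on targets -/

namespace PHORS

variable {G : PHORS}

/-- `Ev G t f`: the term `t`, where non-terminals are unfolded up to the depths that they carry,
reaches the target `a` with probability `f a`. -/
inductive Ev (G : PHORS) : CT G.ty .o → (ℕ → ℝ≥0∞) → Prop
  | Ω : Ev G .Ω fun _ => 0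
  | tgt (a : ℕ) : Ev G (.tgt a) (Pi.single a 1)
  | zero (F : G.NT) (a : ∀ τ, Param (G.ty F) τ → CT G.ty τ) :
      Ev G ((CT.nt F 0 rfl).apps a) fun _ => 0
  | succ {F : G.NT} {k : ℕ} {a : ∀ τ, Param (G.ty F) τ → CT G.ty τ} {f g : ℕ → ℝ≥0∞}
      (hf : Ev G ((G.tL F).inst k a) f) (hg : Ev G ((G.tR F).inst k a) g) :
      Ev G ((CT.nt F (k + 1) rfl).apps a) fun b =>
        ENNReal.ofReal (G.dirProb F .L : ℝ) * f b + ENNReal.ofReal (G.dirProb F .R : ℝ) * g b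

theorem Ev.congr {t : CT G.ty .o} {f g : ℕ → ℝ≥0∞} (h : Ev G t f) (hfg : ∀ a, g a = f a) :
    Ev G t g := by
  rwa [funext hfg]

/-- Rules that do not contain `e` create no targets, so only targets present in the term can be
reached. -/
theorem Ev.eq_zero_of_below (hG : G.EFree) {t : CT G.ty .o} {f : ℕ → ℝ≥0∞} (h : Ev G t f) {M : ℕ}
    (ht : t.Below M) {a : ℕ} (ha : M ≤ a) : f a = 0 := by
  induction h with
  | Ω => rfl
  | tgt b =>
    have : b < M := ht
    exact Pi.single_eq_of_ne (by omega) _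
  | zero => rfl
  | @succ F k as f g _ _ ihf ihg =>
    have := (CT.below_apps.1 ht).2
    simp only [ihf (Tm.below_inst this (hG F).1), ihg (Tm.below_inst this (hG F).2), mul_zero,
      add_zero]

open Classical in
/-- Replacing the targets `b x` by terms with distributions `g x`. -/
theorem Ev.tsub (hG : G.EFree) {ι : Type} {b : ι → ℕ} (hb : b.Injective) {θ : ℕ → CT G.ty .o}
    {g : ι → ℕ → ℝ≥0∞} (hg : ∀ x, Ev G (θ (b x)) (g x)) (hθ : ∀ a ∉ Set.range b, θ a = .tgt a)
    {t : CT G.ty .o} {f : ℕ → ℝ≥0∞} (h : Ev G t f) :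
    Ev G (t.tsub θ) fun a =>
      (if a ∈ Set.range b then 0 else f a) + ∑' x, f (b x) * g x a := by
  induction h with
  | Ω => exact Ev.Ω.congr fun a => by simp
  | tgt c =>
    by_cases hc : c ∈ Set.range b
    · obtain ⟨y, rfl⟩ := hc
      refine (hg y).congr fun a => ?_
      rw [tsum_eq_single y]
      · by_cases ha : a ∈ Set.range b
        · simp [ha]
        · have : a ≠ b y := fun h => ha ⟨y, h.symm⟩
          simp [this]
      · intro x hx
        simp [hb.ne hx]
    · rw [CT.tsub, hθ c hc]
      refine (Ev.tgt c).congr fun a => ?_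
      have h0 : ∀ x, (Pi.single c 1 : ℕ → ℝ≥0∞) (b x) = 0 := fun x =>
        Pi.single_eq_of_ne (fun h => hc ⟨x, h⟩) _
      simp only [h0, zero_mul, tsum_zero, add_zero]
      split_ifs with ha
      · have hac : a ≠ c := fun h => hc (h ▸ ha)
        simp [hac]
      · rfl
  | zero F a =>
    rw [CT.tsub_apps]
    exact (Ev.zero F _).congr fun a => by simp
  | @succ F k as f₁ f₂ _ _ ih₁ ih₂ =>
    rw [CT.tsub_apps]
    rw [Tm.tsub_inst _ _ _ (hG F).1] at ih₁
    rw [Tm.tsub_inst _ _ _ (hG F).2] at ih₂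
    refine (Ev.succ ih₁ ih₂).congr fun a => ?_
    -- The claimed formula is linear in `f`, hence compatible with the probabilistic choice.
    simp only [mul_add, ← ENNReal.tsum_mul_left, add_mul, mul_assoc, ENNReal.tsum_add]
    split_ifs
    · simp
    · ring

/-- Cutting off at the unfolding depths only loses terminating runs. -/
theorem Ev.le_prob {t : CT G.ty .o} {f : ℕ → ℝ≥0∞} (h : Ev G t f) : f 0 ≤ G.prob t.erase := by
  induction h with
  | Ω => exact zero_le
  | tgt a =>
    by_cases ha : a = 0
    · subst ha
      simp [CT.erase, prob_e]
    · simp [Ne.symm ha]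
  | zero => exact zero_le
  | @succ F k as f g _ _ ihf ihg =>
    rw [Tm.erase_inst] at ihf ihg
    rw [CT.erase_apps]
    exact (add_le_add (mul_le_mul_right ihf _) (mul_le_mul_right ihg _)).trans (prob_apps F _).ge

/-- Each step lowers the depth of the new non-terminals to one below that of the unfolded one, so
runs of fewer than `n` steps are never cut off. -/
theorem Ev.probLT_le {t : CT G.ty .o} {f : ℕ → ℝ≥0∞} (h : Ev G t f) {n : ℕ} (ht : t.DepthGE n) :
    G.probLT t.erase n ≤ f 0 := by
  induction h generalizing n with
  | Ω => exact (probLT_Ω n).le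
  | tgt a =>
    by_cases ha : a = 0
    · subst ha
      simpa [CT.erase] using probLT_e_le n
    · simp [ha, CT.erase, probLT_Ω]
  | zero F a =>
    have : n = 0 := Nat.le_zero.1 (CT.depthGE_apps.1 ht).1
    rw [this, probLT_zero]
  | @succ F k as f g _ _ ihf ihg =>
    cases n with
    | zero => rw [probLT_zero]; exact zero_le
    | succ n =>
      obtain ⟨hk, has⟩ := CT.depthGE_apps.1 ht
      have hk : n ≤ k := Nat.le_of_succ_le_succ hk
      have has : ∀ τ v, (as τ v).DepthGE n := fun τ v => (has τ v).mono n.le_succ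
      have hf := ihf (Tm.depthGE_inst hk has _)
      have hg := ihg (Tm.depthGE_inst hk has _)
      rw [Tm.erase_inst] at hf hg
      rw [CT.erase_apps]
      exact (probLT_apps_succ F _ n).le.trans
        (add_le_add (mul_le_mul_right hf _) (mul_le_mul_right hg _))

end PHORS

/-! ## Argument positions -/

/-- An argument position before the maximal order-0 postfix. -/
def YVar.param : {c τ : Ty} → YVar c τ → Param c τ
  | _, _, .here _ => .here
  | _, _, .there y => .there y.param

/-- An argument position in the maximal order-0 postfix. -/
def XVar.param : {c : Ty} → XVar c → Param c .o
  | _, .here _ => .here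
  | _, .there x => .there x.param

/-- The argument position underlying a classified one. -/
def Kind.param {c : Ty} : {τ : Ty} → Kind c τ → Param c τ
  | _, .y v => v.param
  | _, .x v => v.param

/-- Together with `YVar.kind_param` and `XVar.kind_param`: positions may be treated by cases on
their classification. -/
theorem Param.param_kind {c τ : Ty} (v : Param c τ) : v.kind.param = v := by
  induction v with
  | @here κ σ =>
    cases κ
    · by_cases h : (Ty.arr .o σ).ground = true
      · simp [Param.kind, h, Kind.param, XVar.param]
      · simp [Param.kind, h, Kind.param, YVar.param]
    · rfl
  | @there κ σ τ v ih =>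
    have : (Param.there (κ := κ) v).kind.param = .there v.kind.param := by
      cases κ <;> simp only [Param.kind] <;> cases v.kind <;> rfl
    rw [this, ih]

theorem YVar.kind_param {c τ : Ty} (y : YVar c τ) : y.param.kind = .y y := by
  induction y with
  | @here κ σ h => cases κ <;> simp [YVar.param, Param.kind, h]
  | @there κ σ τ y ih => cases κ <;> simp [YVar.param, Param.kind, ih]

theorem XVar.kind_param {c : Ty} (x : XVar c) : x.param.kind = .x x := by
  induction x with
  | @here σ h => simp [XVar.param, Param.kind, h]
  | @there κ σ y ih => cases κ <;> simp [XVar.param, Param.kind, ih]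

/-- There are finitely many argument positions, so the maximum of the individual bounds serves all
of them. -/
theorem exists_forall_param {σ : Ty} {P : ∀ τ, Param σ τ → ℕ → Prop}
    (hmono : ∀ τ v M M', M ≤ M' → P τ v M → P τ v M') (h : ∀ τ v, ∃ M, P τ v M) :
    ∃ M, ∀ τ v, P τ v M := by
  induction σ with
  | o => exact ⟨0, nofun⟩
  | arr κ σ _ ih =>
    obtain ⟨M₁, h₁⟩ := h _ .here
    obtain ⟨M₂, h₂⟩ := ih (P := fun τ v => P τ (.there v)) (fun τ v => hmono τ _) fun τ v => h τ _
    exact ⟨max M₁ M₂, forall_param_arr.2 ⟨hmono _ _ _ _ (le_max_left _ _) h₁,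
      fun τ v => hmono _ _ _ _ (le_max_right _ _) (h₂ τ v)⟩⟩

theorem tsum_xvar_of_ground {σ : Ty} (h : (Ty.arr .o σ).ground = true)
    (f : XVar (.arr .o σ) → ℝ≥0∞) : ∑' x, f x = f (.here h) + ∑' x, f (.there x) := by
  let e : Unit ⊕ XVar σ ≃ XVar (.arr .o σ) :=
    { toFun := fun s => match s with
        | .inl _ => .here h
        | .inr x => .there x
      invFun := fun s => match s with
        | .here _ => .inl ()
        | .there x => .inr x
      left_inv := fun s => by cases s <;> rfl
      right_inv := fun s => by cases s <;> rfl }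
  rw [← e.tsum_eq, ENNReal.summable.tsum_sum ENNReal.summable, tsum_fintype, Finset.univ_unique,
    Finset.sum_singleton]
  rfl

theorem tsum_xvar_of_not_ground {κ σ : Ty} (h : (Ty.arr κ σ).ground = false)
    (f : XVar (.arr κ σ) → ℝ≥0∞) : ∑' x, f x = ∑' x, f (.there x) := by
  let e : XVar σ ≃ XVar (.arr κ σ) :=
    Equiv.ofBijective (fun x => .there x) ⟨fun x y h => by injection h, fun x => by
      cases x with
      | here h' => rw [h] at h'; cases h'
      | there x => exact ⟨x, rfl⟩⟩
  rw [← e.tsum_eq]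
  rfl

/-! ## Transport along equalities of types -/

/-- Transport of values along an equality of types. -/
def Sem.cast {τ τ' : RTy} (h : τ = τ') : Sem τ → Sem τ' := _root_.cast (congrArg Sem h)

/-- Transport of lists of values along an equality of types. -/
def ArgVals.cast {τ τ' : RTy} (h : τ = τ') : ArgVals τ → ArgVals τ' :=
  _root_.cast (congrArg ArgVals h)

theorem Sem.applyAll_arr_cast {τ a τ' : RTy} (h : τ = .arr a τ') (g : Sem τ) (x : Sem a)
    (xs : ArgVals τ') :
    Sem.applyAll τ g (ArgVals.cast h.symm (show ArgVals (.arr a τ') from (x, xs))) =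
      Sem.applyAll τ' (Sem.app (g.cast h) x) xs := by
  subst h; rfl

theorem PVar.get_cast {τ τ' σ : RTy} (h : τ' = τ) (z : PVar τ' σ) (xs : ArgVals τ') :
    (h ▸ z : PVar τ σ).get (ArgVals.cast h xs) = z.get xs := by
  subst h; rfl

namespace Expr

variable {Fn : RTy → Type} {V : RTy → Type v} {W : RTy → Type w}

theorem eval_cast {τ τ' : RTy} (h : τ = τ') (e : Expr Fn V τ) (ρ : ∀ τ, Fn τ → Sem τ)
    (η : ∀ τ, V τ → Sem τ) : (e.cast h).eval ρ η = (e.eval ρ η).cast h := by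
  subst h; rfl

theorem eval_rename {τ : RTy} (r : ∀ τ, V τ → W τ) (e : Expr Fn V τ) (ρ : ∀ τ, Fn τ → Sem τ)
    (η : ∀ τ, W τ → Sem τ) : (e.rename r).eval ρ η = e.eval ρ fun τ z => η τ (r τ z) := by
  induction e with
  | add e₁ e₂ ih₁ ih₂ => simp only [rename, eval, ih₁, ih₂]; rfl
  | mul e₁ e₂ ih₁ ih₂ => simp only [rename, eval, ih₁, ih₂]; rfl
  | app e₁ e₂ ih₁ ih₂ => simp only [rename, eval, ih₁, ih₂]
  | tuple es ih => simp only [rename, eval, ih]; rfl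
  | _ => rfl

end Expr

/-! ## Values of terms -/

/-- The values `(v_a)_a, v_1, …, v_ℓ, v_{ℓ+1}` of a term of type `σ` and arity `ℓ`, for all targets
`a`, for the arguments, and for a fresh target. -/
structure Val (σ : Ty) where
  tgt : ℕ → Sem (comp σ .full)
  arg : XVar σ → Sem (comp σ .prime)
  fresh : Sem (comp σ .full)

namespace Val

/-- The tuple `(x, v_1, …, v_ℓ, v_{ℓ+1})` or `(v_1, …, v_ℓ, v_{ℓ+1})`. -/
def tup {κ : Ty} (v : Val κ) (x : Sem (comp κ .full)) (m : Mode) : Sem (dag κ m) :=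
  fun j => match j with
    | .cur => x
    | .arg i => v.arg i
    | .fresh => v.fresh

/-- Application to an argument that does not belong to the order-0 postfix. -/
def appY {κ σ : Ty} (h : (Ty.arr κ σ).ground = false) (v : Val (.arr κ σ)) (w : Val κ) : Val σ where
  tgt a := Sem.app ((v.tgt a).cast (comp_arr h .full)) (w.tup (w.tgt a) .full)
  arg i := Sem.app ((v.arg (.there i)).cast (comp_arr h .prime)) (w.tup w.fresh .prime)
  fresh := Sem.app (v.fresh.cast (comp_arr h .full)) (w.tup w.fresh .full)

/-- `x + y z`, where `y` and `x` are real numbers up to an equality of types. -/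
def linear {τ₁ τ₂ τ : RTy} (h₁ : τ₁ = .real) (h₂ : τ₂ = .real) (h : τ = .real) (x : Sem τ₁)
    (y : Sem τ₂) (z : ℝ≥0∞) : Sem τ :=
  Sem.cast (τ := .real) h.symm
    ((show ℝ≥0∞ from x.cast h₁) + (show ℝ≥0∞ from y.cast h₂) * z : ℝ≥0∞)

/-- The types are variables so that the equalities can be eliminated; the argument lists are
arbitrary because `real` takes no arguments. -/
theorem applyAll_linear {τ₁ τ₂ τ : RTy} (h₁ : τ₁ = .real) (h₂ : τ₂ = .real) (h : τ = .real)
    (x : Sem τ₁) (y : Sem τ₂) (z : ℝ≥0∞) (xs : ArgVals τ) (xs₁ : ArgVals τ₁) (xs₂ : ArgVals τ₂) :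
    Sem.applyAll τ (linear h₁ h₂ h x y z) xs =
      Sem.applyAll τ₁ x xs₁ + Sem.applyAll τ₂ y xs₂ * z := by
  subst h₁ h₂ h; rfl

theorem applyAll_cast_real {τ₁ τ : RTy} (h₁ : τ₁ = .real) (h : τ = .real) (x : Sem τ₁)
    (xs : ArgVals τ) (xs₁ : ArgVals τ₁) :
    Sem.applyAll τ (x.cast (h₁.trans h.symm)) xs = Sem.applyAll τ₁ x xs₁ := by
  subst h₁ h; rfl

/-- Application to an argument in the order-0 postfix. -/
def appX : {κ σ : Ty} → (Ty.arr κ σ).ground = true → Val (.arr κ σ) → Val κ → Val σ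
  | .o, _, h, v, w =>
    { tgt := fun a => linear (comp_ground h _) (comp_ground h _) (comp_ground (ground_of_arr h) _)
        (v.tgt a) (v.arg (.here h)) (w.tgt a)
      arg := fun i => (v.arg (.there i)).cast
        ((comp_ground h .prime).trans (comp_ground (ground_of_arr h) _).symm)
      fresh := linear (comp_ground h _) (comp_ground h _) (comp_ground (ground_of_arr h) _)
        v.fresh (v.arg (.here h)) w.fresh }
  | .arr _ _, _, h, _, _ => absurd h (by simp [Ty.ground])

/-- Application. -/
def app {κ σ : Ty} (v : Val (.arr κ σ)) (w : Val κ) : Val σ :=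
  if h : (Ty.arr κ σ).ground = true then v.appX h w else v.appY (by simpa using h) w

/-- Application to all arguments. -/
def apps : {σ : Ty} → Val σ → (∀ τ, Param σ τ → Val τ) → Val .o
  | .o, v, _ => v
  | .arr _ _, v, w => apps (v.app (w _ .here)) fun _ x => w _ (.there x)

theorem app_tgt_eq_fresh {κ σ : Ty} {v : Val (.arr κ σ)} {w : Val κ} {a : ℕ}
    (hv : v.tgt a = v.fresh) (hw : w.tgt a = w.fresh) : (v.app w).tgt a = (v.app w).fresh := by
  by_cases h : (Ty.arr κ σ).ground = true
  · rw [app, dif_pos h]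
    cases κ with
    | o => simp only [appX, hv, hw]
    | arr => simp [Ty.ground] at h
  · rw [app, dif_neg h]
    simp only [appY, hv, hw]

/-- The values of the tuples of arguments of a function of type `σ`, where the components `0` are
given by `x`. -/
def argVals (m : Mode) : {σ : Ty} → (∀ τ, Param σ τ → Val τ) →
    (∀ τ, Param σ τ → Sem (comp τ .full)) → ArgVals (comp σ m)
  | .o, _, _ => ()
  | .arr κ σ, w, x =>
    if h : (Ty.arr κ σ).ground = true then
      ArgVals.cast (τ := .real) (comp_ground h m).symm ()
    else
      ArgVals.cast (comp_arr (by simpa using h) m).symm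
        (show ArgVals (.arr (dag κ m) (comp σ m)) from ((w _ .here).tup (x _ .here) m,
          argVals m (fun _ z => w _ (.there z)) fun _ z => x _ (.there z)))

theorem get_argVals {m : Mode} {c κ : Ty} (w : ∀ τ, Param c τ → Val τ)
    (x : ∀ τ, Param c τ → Sem (comp τ .full)) (y : YVar c κ) (j : Slot (XVar κ) m) :
    (y.bound j).get (argVals m w x) = (w _ y.param).tup (x _ y.param) m j := by
  induction y with
  | here h =>
    rw [argVals, dif_neg (by simp [h]), YVar.bound, PVar.get_cast]
    rfl
  | there y ih =>
    rw [argVals, dif_neg (by simp [(YVar.there y).ground_eq]), YVar.bound, PVar.get_cast]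
    exact ih _ _ j

/-- The linear decomposition on the side of values. Arguments before the order-0 postfix are passed
to every component; each argument in the postfix adds one product to the component of the target. In
mode `prime` there is no component `0`, so `fresh` is only a filler there. -/
theorem apps_tgt {σ : Ty} (v : Val σ) (w : ∀ τ, Param σ τ → Val τ) (a : ℕ) :
    (show ℝ≥0∞ from (v.apps w).tgt a) =
      Sem.applyAll _ (v.tgt a) (argVals .full w fun _ z => (w _ z).tgt a) +
        ∑' x : XVar σ, Sem.applyAll _ (v.arg x) (argVals .prime w fun _ z => (w _ z).fresh) *
          (show ℝ≥0∞ from (w _ x.param).tgt a) := by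
  induction σ with
  | o =>
    have : IsEmpty (XVar .o) := ⟨nofun⟩
    rw [tsum_empty, add_zero]
    rfl
  | arr κ σ _ ih =>
    rw [apps, ih]
    by_cases h : (Ty.arr κ σ).ground = true
    · cases κ with
      | arr => simp [Ty.ground] at h
      | o =>
        rw [tsum_xvar_of_ground h, ← add_assoc, app, dif_pos h]
        have hσ := fun m => comp_ground (ground_of_arr h) m
        have h' := fun m => comp_ground h m
        exact congrArg₂ (· + ·) (applyAll_linear (h' _) (h' _) (hσ _) _ _ _ _ _ _)
          (tsum_congr fun x => congrArg (· * _) (applyAll_cast_real (h' _) (hσ _) _ _ _))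
    · have h' : (Ty.arr κ σ).ground = false := by simpa using h
      rw [tsum_xvar_of_not_ground h', app, dif_neg h, argVals, dif_neg h, argVals, dif_neg h]
      exact congrArg₂ (· + ·) (Sem.applyAll_arr_cast (comp_arr h' _) _ _ _).symm
        (tsum_congr fun x => congrArg (· * _) (Sem.applyAll_arr_cast (comp_arr h' _) _ _ _).symm)

end Val

/-! ## Values of translated terms -/

section Translation

variable {ν : Type} {N : ν → Ty} {c : Ty}

/-- The values of the variables `y_{i,j}`, where `y_{i,0}` is given by `x`. -/
def TVar.val {m : Mode} (w : ∀ τ, Param c τ → Val τ) (x : ∀ τ, Param c τ → Sem (comp τ .full)) :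
    ∀ τ, TVar c m τ → Sem τ
  | _, .mk y j => (w _ y.param).tup (x _ y.param) m j

/-- The values of the variables for the current target `a`. -/
abbrev TVar.full (w : ∀ τ, Param c τ → Val τ) (a : ℕ) : ∀ τ, TVar c .full τ → Sem τ :=
  TVar.val w fun _ z => (w _ z).tgt a

/-- The values of the variables in mode `prime`. -/
abbrev TVar.prime (w : ∀ τ, Param c τ → Val τ) : ∀ τ, TVar c .prime τ → Sem τ :=
  TVar.val w fun _ z => (w _ z).fresh

theorem TVar.get_bound {m : Mode} (w : ∀ τ, Param c τ → Val τ)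
    (x : ∀ τ, Param c τ → Sem (comp τ .full)) {τ : RTy} (z : TVar c m τ) :
    (z.bound).get (Val.argVals m w x) = TVar.val w x τ z := by
  cases z with
  | mk y j => exact Val.get_argVals w x y j

/-- Without the variables `y_{i,0}` an expression cannot depend on the current target. -/
theorem TExpr.eval_incl {τ : RTy} (e : TExpr N c .prime τ) (ρ : ∀ τ, FSym N τ → Sem τ)
    (w : ∀ τ, Param c τ → Val τ) (a : ℕ) :
    (TExpr.incl e).eval ρ (TVar.full w a) = e.eval ρ (TVar.prime w) := by
  rw [TExpr.incl, Expr.eval_rename]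
  congr 1
  funext τ z
  rcases z with ⟨y, _ | _ | _⟩ <;> rfl

/-- The value of a translated term, where `b x` is the target for the order-0 parameter `x`. -/
def Out.val {σ : Ty} (o : Out N c σ) (ρ : ∀ τ, FSym N τ → Sem τ) (w : ∀ τ, Param c τ → Val τ)
    (b : XVar c → ℕ) : Val σ where
  tgt := Function.extend b (fun x => (o.loc x).eval ρ (TVar.prime w))
    fun a => o.cur.eval ρ (TVar.full w a)
  arg i := (o.arg i).eval ρ (TVar.prime w)
  fresh := o.fresh.eval ρ (TVar.prime w)

theorem Out.val_tgt_apply {σ : Ty} (o : Out N c σ) (ρ : ∀ τ, FSym N τ → Sem τ)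
    (w : ∀ τ, Param c τ → Val τ) {b : XVar c → ℕ} (hb : b.Injective) (x : XVar c) :
    (o.val ρ w b).tgt (b x) = (o.loc x).eval ρ (TVar.prime w) := by
  simp only [Out.val, hb.extend_apply]

theorem Out.val_tgt_of_notMem {σ : Ty} (o : Out N c σ) (ρ : ∀ τ, FSym N τ → Sem τ)
    (w : ∀ τ, Param c τ → Val τ) {b : XVar c → ℕ} {a : ℕ} (ha : a ∉ Set.range b) :
    (o.val ρ w b).tgt a = o.cur.eval ρ (TVar.full w a) := by
  simp only [Out.val, Function.extend_apply' _ _ _ ha]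

/-- The value of a non-terminal. -/
def Val.nt (ρ : ∀ τ, FSym N τ → Sem τ) (F : ν) {σ : Ty} (h : N F = σ) : Val σ where
  tgt _ := ρ _ (.cur F h)
  arg i := ρ _ (.arg F h i)
  fresh := ρ _ (.cur F h)

theorem eval_tupleFull {κ : Ty} {m : Mode} (e : TExpr N c m (comp κ .full))
    (es : XVar κ → TExpr N c m (comp κ .prime)) (d : TExpr N c m (comp κ .full))
    (ρ : ∀ τ, FSym N τ → Sem τ) (η : ∀ τ, TVar c m τ → Sem τ) (v : Val κ)
    (hes : ∀ i, (es i).eval ρ η = v.arg i) (hd : d.eval ρ η = v.fresh) :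
    (tupleFull e es d).eval ρ η = v.tup (e.eval ρ η) .full := by
  funext j
  cases j
  exacts [rfl, hes _, hd]

theorem eval_tuplePrime {κ : Ty} {m : Mode}
    (es : XVar κ → TExpr N c m (comp κ .prime)) (d : TExpr N c m (comp κ .full))
    (ρ : ∀ τ, FSym N τ → Sem τ) (η : ∀ τ, TVar c m τ → Sem τ) (v : Val κ) (x : Sem (comp κ .full))
    (hes : ∀ i, (es i).eval ρ η = v.arg i) (hd : d.eval ρ η = v.fresh) :
    (tuplePrime es d).eval ρ η = v.tup x .prime := by
  funext j
  cases j
  exacts [hes _, hd]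

theorem Val.ext' {σ : Ty} {v v' : Val σ} (h₁ : ∀ a, v.tgt a = v'.tgt a)
    (h₂ : ∀ i, v.arg i = v'.arg i) (h₃ : v.fresh = v'.fresh) : v = v' := by
  cases v; cases v'
  simp only at h₁ h₂ h₃
  rw [funext h₁, funext h₂, h₃]

section Val

variable (ρ : ∀ τ, FSym N τ → Sem τ) (w : ∀ τ, Param c τ → Val τ) {b : XVar c → ℕ}
  (hb : b.Injective)

include hb

/-- Compositionality: the components of the translation are those of `Val.app`, checked separately
for a target `b x` of an order-0 parameter, any other target, the arguments and the fresh target. -/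
theorem Out.val_app {κ σ : Ty} (h : (Ty.arr κ σ).ground = false) (s : Out N c (.arr κ σ))
    (t : Out N c κ) : (Out.app h s t).val ρ w b = (s.val ρ w b).app (t.val ρ w b) := by
  rw [Val.app, dif_neg (by simp [h])]
  refine Val.ext' (fun a => ?_) (fun i => ?_) ?_
  · by_cases ha : ∃ x, b x = a
    · obtain ⟨x, rfl⟩ := ha
      simp only [Out.val, Val.appY, hb.extend_apply, Out.app, Expr.eval, Expr.eval_cast]
      congr 1
      exact eval_tupleFull _ _ _ _ _ (t.val ρ w b) (fun _ => rfl) rfl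
    · simp only [Out.val, Val.appY, Function.extend_apply' _ _ _ ha, Out.app, Expr.eval,
        Expr.eval_cast]
      congr 1
      exact eval_tupleFull _ _ _ _ _ (t.val ρ w b) (fun _ => TExpr.eval_incl _ _ _ _)
        (TExpr.eval_incl _ _ _ _)
  · simp only [Out.val, Val.appY, Out.app, Expr.eval, Expr.eval_cast]
    congr 1
    exact eval_tuplePrime _ _ _ _ (t.val ρ w b) _ (fun _ => rfl) rfl
  · simp only [Out.val, Val.appY, Out.app, Expr.eval, Expr.eval_cast]
    congr 1
    exact eval_tupleFull _ _ _ _ _ (t.val ρ w b) (fun _ => rfl) rfl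

theorem Out.val_appG {κ σ : Ty} (h : (Ty.arr κ σ).ground = true) (s : Out N c (.arr κ σ))
    (t : Out N c κ) : (Out.appG h s t).val ρ w b = (s.val ρ w b).app (t.val ρ w b) := by
  rw [Val.app, dif_pos h]
  cases κ with
  | arr => simp [Ty.ground] at h
  | o =>
    refine Val.ext' (fun a => ?_) (fun i => ?_) ?_
    · by_cases ha : ∃ x, b x = a
      · obtain ⟨x, rfl⟩ := ha
        simp only [Out.val, Val.appX, hb.extend_apply, Out.appG, Expr.eval, Expr.eval_cast]
        rfl
      · simp only [Out.val, Val.appX, Function.extend_apply' _ _ _ ha, Out.appG, Expr.eval,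
          Expr.eval_cast, TExpr.eval_incl]
        rfl
    · simp only [Out.val, Val.appX, Out.appG, Expr.eval_cast]
    · simp only [Out.val, Val.appX, Out.appG, Expr.eval, Expr.eval_cast]
      rfl

end Val

/-- The translation uses `y_{ℓ+1}` for every order-0 parameter, which is right only if the targets
`b x` are fresh for the actual argument. -/
theorem Out.val_yvar (ρ : ∀ τ, FSym N τ → Sem τ) (w : ∀ τ, Param c τ → Val τ) {b : XVar c → ℕ}
    {σ : Ty} (y : YVar c σ) (hy : ∀ x, (w _ y.param).tgt (b x) = (w _ y.param).fresh) :
    (Out.yvar (N := N) y).val ρ w b = w _ y.param := by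
  refine Val.ext' (fun a => ?_) (fun i => rfl) rfl
  by_cases ha : ∃ x, b x = a
  · have : b ha.choose = a := ha.choose_spec
    rw [← this, hy]
    classical
    simp only [Out.val, Function.extend_def]
    rw [dif_pos ⟨_, rfl⟩]
    rfl
  · simp only [Out.val, Function.extend_apply' _ _ _ ha]
    rfl

theorem Out.val_nt (ρ : ∀ τ, FSym N τ → Sem τ) (w : ∀ τ, Param c τ → Val τ) (b : XVar c → ℕ)
    {σ : Ty} (F : ν) (h : N F = σ) : (Out.nt (c := c) F h).val ρ w b = Val.nt ρ F h := by
  refine Val.ext' (fun a => ?_) (fun i => rfl) rfl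
  classical
  simp only [Out.val, Function.extend_def]
  split_ifs <;> rfl

theorem Out.val_omega_tgt (ρ : ∀ τ, FSym N τ → Sem τ) (w : ∀ τ, Param c τ → Val τ)
    (b : XVar c → ℕ) (a : ℕ) : (Out.omega.val ρ w b).tgt a = (0 : ℝ≥0∞) := by
  classical
  simp only [Out.val, Function.extend_def]
  split_ifs <;> exact ENNReal.ofReal_zero

theorem Out.val_gvar_tgt (ρ : ∀ τ, FSym N τ → Sem τ) (w : ∀ τ, Param c τ → Val τ) {b : XVar c → ℕ}
    (hb : b.Injective) (x : XVar c) (a : ℕ) :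
    ((Out.gvar x).val ρ w b).tgt a = (Pi.single (b x) 1 : ℕ → ℝ≥0∞) a := by
  by_cases ha : ∃ x, b x = a
  · obtain ⟨x', rfl⟩ := ha
    simp only [Out.val, hb.extend_apply, Out.gvar]
    by_cases hx : x' = x
    · subst hx
      rw [Pi.single_eq_same]
      exact (congrArg (Expr.eval ρ (TVar.prime w)) (if_pos rfl)).trans ENNReal.ofReal_one
    · rw [Pi.single_eq_of_ne (hb.ne hx)]
      exact (congrArg (Expr.eval ρ (TVar.prime w)) (if_neg hx)).trans ENNReal.ofReal_zero
  · have : a ≠ b x := fun h => ha ⟨x, h.symm⟩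
    simp only [Out.val, Function.extend_apply' _ _ _ ha]
    rw [Pi.single_eq_of_ne this]
    exact ENNReal.ofReal_zero

end Translation

namespace PHORS

variable {G : PHORS}

/-! ## The logical relation between closed terms and values -/

/-- Almost all targets do not occur in `t`, and their value is that of a fresh target. -/
def Fresh {σ : Ty} (t : CT G.ty σ) (v : Val σ) : Prop :=
  ∃ M, t.Below M ∧ ∀ a, M ≤ a → v.tgt a = v.fresh

theorem Fresh.app {κ σ : Ty} {t : CT G.ty (.arr κ σ)} {v : Val (.arr κ σ)} {u : CT G.ty κ}
    {w : Val κ} (ht : Fresh t v) (hu : Fresh u w) : Fresh (t.app u) (v.app w) := by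
  obtain ⟨M, hM, hv⟩ := ht
  obtain ⟨M', hM', hw⟩ := hu
  exact ⟨max M M', ⟨hM.mono (le_max_left _ _), hM'.mono (le_max_right _ _)⟩, fun a ha =>
    Val.app_tgt_eq_fresh (hv a (le_of_max_le_left ha)) (hw a (le_of_max_le_right ha))⟩

/-- The logical relation: `v` describes the reachability probabilities of `t`. -/
def Rel (G : PHORS) : {σ : Ty} → CT G.ty σ → Val σ → Prop
  | .o, t, v => Fresh t v ∧ G.Ev t v.tgt
  | .arr κ _, t, v => Fresh t v ∧ ∀ (u : CT G.ty κ) w, Rel G u w → Rel G (t.app u) (v.app w)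

theorem Rel.fresh {σ : Ty} {t : CT G.ty σ} {v : Val σ} (h : G.Rel t v) : Fresh t v := by
  cases σ
  exacts [h.1, h.1]

theorem Rel.ev {t : CT G.ty .o} {v : Val .o} (h : G.Rel t v) : G.Ev t v.tgt :=
  h.2

theorem Rel.app {κ σ : Ty} {t : CT G.ty (.arr κ σ)} {v : Val (.arr κ σ)} {u : CT G.ty κ}
    {w : Val κ} (h : G.Rel t v) (hu : G.Rel u w) : G.Rel (t.app u) (v.app w) :=
  h.2 u w hu

/-- Reduces the relation at any type to full applications, where `Ev` and `Val.apps_tgt` are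
available. -/
theorem rel_of_apps {σ : Ty} {t : CT G.ty σ} {v : Val σ} (hf : Fresh t v)
    (h : ∀ (a : ∀ τ, Param σ τ → CT G.ty τ) (w : ∀ τ, Param σ τ → Val τ),
      (∀ τ z, G.Rel (a τ z) (w τ z)) → G.Ev (t.apps a) (v.apps w).tgt) : G.Rel t v := by
  induction σ with
  | o => exact ⟨hf, h nofun nofun nofun⟩
  | arr κ σ _ ih =>
    refine ⟨hf, fun u w hu => ih (hf.app hu.fresh) fun as ws has => ?_⟩
    exact h (fun _ z => match z with | .here => u | .there z => as _ z)
      (fun _ z => match z with | .here => w | .there z => ws _ z) (forall_param_arr.2 ⟨hu, has⟩)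

/-- The fundamental lemma for the bodies of rules, where the order-0 parameters are replaced by
distinct targets. -/
theorem rel_inst {ρ : ∀ τ, FSym G.ty τ → Sem τ} {k : ℕ}
    (hρ : ∀ F, G.Rel (.nt F k rfl) (Val.nt ρ F rfl)) {c : Ty} {as : ∀ τ, Param c τ → CT G.ty τ}
    {w : ∀ τ, Param c τ → Val τ} {b : XVar c → ℕ} (hb : b.Injective)
    (hy : ∀ τ (y : YVar c τ), G.Rel (as _ y.param) (w _ y.param))
    (hx : ∀ x : XVar c, as _ x.param = .tgt (b x))
    (hw : ∀ τ (y : YVar c τ) x, (w _ y.param).tgt (b x) = (w _ y.param).fresh)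
    {σ : Ty} (t : Tm G.ty c σ) (ht : t.NoE) : G.Rel (t.inst k as) ((t.tr ht).val ρ w b) := by
  induction t with
  | e => exact ht.elim
  | Ω =>
    refine ⟨⟨0, trivial, fun a _ => ?_⟩, Ev.Ω.congr fun a => Out.val_omega_tgt ρ w b a⟩
    exact (Out.val_omega_tgt ρ w b a).trans ENNReal.ofReal_zero.symm
  | var v =>
    -- Stated for an arbitrary classified position, so that cases can be taken; `param_kind` returns
    -- to `v`.
    have key : ∀ {τ : Ty} (q : Kind c τ),
        G.Rel (as _ q.param) ((Out.ofKind (N := G.ty) q).val ρ w b) := by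
      rintro _ (y | x)
      · change G.Rel (as _ y.param) ((Out.yvar y).val ρ w b)
        rw [Out.val_yvar ρ w y (hw _ y)]
        exact hy _ y
      · change G.Rel (as _ x.param) ((Out.gvar x).val ρ w b)
        rw [hx x]
        refine ⟨⟨b x + 1, Nat.lt_succ_self _, fun a ha => ?_⟩,
          (Ev.tgt _).congr fun a => Out.val_gvar_tgt ρ w hb x a⟩
        refine (Out.val_gvar_tgt ρ w hb x a).trans ?_
        rw [Pi.single_eq_of_ne (by omega)]
        exact ENNReal.ofReal_zero.symm
    have := key v.kind
    rw [v.param_kind] at this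
    exact this
  | nt F h =>
    subst h
    rw [Tm.inst, Tm.tr, Out.val_nt]
    exact hρ F
  | app s t ihs iht =>
    rw [Tm.inst, Tm.tr]
    split_ifs with h
    · rw [Out.val_appG ρ w hb]
      exact (ihs ht.1).app (iht ht.2)
    · rw [Out.val_app ρ w hb]
      exact (ihs ht.1).app (iht ht.2)

theorem exists_bound {σ : Ty} {as : ∀ τ, Param σ τ → CT G.ty τ} {w : ∀ τ, Param σ τ → Val τ}
    (h : ∀ τ z, G.Rel (as τ z) (w τ z)) :
    ∃ M, ∀ τ z, (as τ z).Below M ∧ ∀ a, M ≤ a → (w τ z).tgt a = (w τ z).fresh :=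
  exists_forall_param
    (P := fun τ z M => (as τ z).Below M ∧ ∀ a, M ≤ a → (w τ z).tgt a = (w τ z).fresh)
    (fun _ _ _ _ hM h => ⟨h.1.mono hM, fun a ha => h.2 a (hM.trans ha)⟩) fun τ z => (h τ z).fresh

/-- The fundamental lemma for the bodies of rules of type `o`: order-0 arguments contribute
linearly. -/
theorem ev_inst (hG : G.EFree) {ρ : ∀ τ, FSym G.ty τ → Sem τ} {k : ℕ}
    (hρ : ∀ F, G.Rel (.nt F k rfl) (Val.nt ρ F rfl)) {c : Ty} {as : ∀ τ, Param c τ → CT G.ty τ}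
    {w : ∀ τ, Param c τ → Val τ} (h : ∀ τ z, G.Rel (as τ z) (w τ z)) (t : Tm G.ty c .o)
    (ht : t.NoE) :
    G.Ev (t.inst k as) fun a =>
      (show ℝ≥0∞ from (t.tr ht).cur.eval ρ (TVar.full w a)) +
        ∑' x : XVar c, (show ℝ≥0∞ from ((t.tr ht).loc x).eval ρ (TVar.prime w)) *
          (show ℝ≥0∞ from (w _ x.param).tgt a) := by
  obtain ⟨M, hM⟩ := exists_bound h
  obtain ⟨e, he⟩ := Countable.exists_injective_nat (XVar c)
  -- Distinct targets that are fresh for all arguments.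
  let b : XVar c → ℕ := fun x => M + e x
  have hb : b.Injective := fun x y h => he (Nat.add_left_cancel h)
  obtain ⟨M', hM'⟩ : ∃ M', ∀ x, b x < M' := by
    obtain ⟨B, hB⟩ := (Set.finite_range b).bddAbove
    exact ⟨B + 1, fun x => Nat.lt_succ_of_le (hB ⟨x, rfl⟩)⟩
  let as' : ∀ τ, Param c τ → CT G.ty τ := fun τ v =>
    match v.kind with
    | .y y => as _ y.param
    | .x x => .tgt (b x)
  have hasy : ∀ τ (y : YVar c τ), as' _ y.param = as _ y.param := fun τ y => by
    simp only [as', y.kind_param]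
  have hasx : ∀ x : XVar c, as' _ x.param = .tgt (b x) := fun x => by
    simp only [as', x.kind_param]
  have hrel := rel_inst hρ hb (as := as') (w := w)
    (fun τ y => by rw [hasy]; exact h _ _) hasx
    (fun τ y x => (hM _ _).2 _ (Nat.le_add_right _ _)) t ht
  have hev : G.Ev (t.inst k as') ((t.tr ht).val ρ w b).tgt := hrel.2
  -- The target `max M M'` does not occur in the instance, hence is reached with probability 0. All
  -- targets from `M` on give the arguments the same values, so the component vanishes for each of
  -- them, including the `b x`, whose own mass is removed by the substitution below.
  have hcur : ∀ a, M ≤ a →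
      (show ℝ≥0∞ from (t.tr ht).cur.eval ρ (TVar.full w a)) = 0 := fun a ha => by
    have hbelow : (t.inst k as').Below (max M M') := by
      refine Tm.below_inst (fun τ v => ?_) ht
      rw [← v.param_kind]
      generalize v.kind = q
      cases q with
      | y y =>
        change (as' _ y.param).Below _
        rw [hasy]
        exact (hM _ _).1.mono (le_max_left _ _)
      | x x =>
        change (as' _ x.param).Below _
        rw [hasx]
        exact lt_of_lt_of_le (hM' x) (le_max_right _ _)
    have h0 := hev.eq_zero_of_below hG hbelow le_rfl
    have hnot : max M M' ∉ Set.range b := by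
      rintro ⟨x, hx⟩
      exact absurd (hM' x) (by rw [hx]; simp)
    have hfull : TVar.full w a = TVar.full w (max M M') := by
      simp only [TVar.full]
      congr 1
      funext τ z
      rw [(hM τ z).2 a ha, (hM τ z).2 _ (le_max_left _ _)]
    rw [hfull]
    rw [← h0]
    exact (Out.val_tgt_of_notMem _ _ _ hnot).symm
  -- This substitution puts the original order-0 arguments back. The other arguments only contain
  -- targets below `M` and are not affected.
  have hθ : ∀ x, Function.extend b (fun x => as _ x.param) CT.tgt (b x) = as _ x.param :=
    fun x => hb.extend_apply _ _ x
  have hsub := hev.tsub hG hb (θ := Function.extend b (fun x => as _ x.param) CT.tgt)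
    (g := fun x => (w _ x.param).tgt) (fun x => by rw [hθ]; exact (h _ _).ev)
    (fun a ha => Function.extend_apply' _ _ _ ha)
  rw [Tm.tsub_inst _ _ _ ht] at hsub
  have hinst :
      (fun τ v => (as' τ v).tsub (Function.extend b (fun x => as _ x.param) CT.tgt)) = as := by
    funext τ v
    rw [← v.param_kind]
    generalize v.kind = q
    cases q with
    | y y =>
      change (as' _ y.param).tsub _ = as _ y.param
      rw [hasy]
      refine CT.tsub_eq_self (fun a ha => Function.extend_apply' _ _ _ ?_) (hM _ _).1
      rintro ⟨x, rfl⟩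
      exact absurd ha (by simp [b])
    | x x =>
      change (as' _ x.param).tsub _ = as _ x.param
      rw [hasx, CT.tsub, hθ]
  rw [hinst] at hsub
  refine hsub.congr fun a => congrArg₂ (· + ·) ?_ (tsum_congr fun x => congrArg (· * _) ?_)
  · by_cases ha : a ∈ Set.range b
    · refine Eq.trans ?_ (if_pos ha).symm
      obtain ⟨x, rfl⟩ := ha
      exact hcur _ (Nat.le_add_right _ _)
    · exact (Out.val_tgt_of_notMem _ _ _ ha).symm.trans (if_neg ha).symm
  · exact (Out.val_tgt_apply _ _ _ hb x).symm

/-! ### Non-terminals and the Kleene approximations. -/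

theorem eval_choice (F : G.NT) {m : Mode} (l r : TExpr G.ty (G.ty F) m .real)
    (ρ : ∀ τ, FSym G.ty τ → Sem τ) (η : ∀ τ, TVar (G.ty F) m τ → Sem τ) :
    (G.choice F l r).eval ρ η =
      (ENNReal.ofReal (G.dirProb F .L : ℝ) * (show ℝ≥0∞ from l.eval ρ η) +
        ENNReal.ofReal (G.dirProb F .R : ℝ) * (show ℝ≥0∞ from r.eval ρ η) : ℝ≥0∞) := by
  have : ((G.dirProb F .R : ℚ) : ℝ) = 1 - (G.p F : ℝ) := by simp [dirProb]
  rw [this]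
  rfl

theorem zero_add_tsum_zero_mul {ι : Type} (x : ι → ℝ≥0∞) : 0 + ∑' i, 0 * x i = 0 := by simp

theorem linear_combination_tsum {ι : Type} (p q c d : ℝ≥0∞) (l r x : ι → ℝ≥0∞) :
    p * c + q * d + ∑' i, (p * l i + q * r i) * x i =
      p * (c + ∑' i, l i * x i) + q * (d + ∑' i, r i * x i) := by
  simp only [mul_add, add_mul, ENNReal.tsum_add, ← ENNReal.tsum_mul_left, mul_assoc]
  exact add_add_add_comm _ _ _ _

/-- Every non-terminal, unfolded up to depth `k`, is described by the `k`-th approximation. -/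
theorem rel_nt (hG : G.EFree) {ρ : ℕ → ∀ τ, FSym G.ty τ → Sem τ} (hρ : (G.eqs hG).Approximates ρ)
    (k : ℕ) (F : G.NT) : G.Rel (.nt F k rfl) (Val.nt (ρ k) F rfl) := by
  induction k generalizing F with
  | zero =>
    refine rel_of_apps ⟨0, trivial, fun _ _ => rfl⟩ fun as w _ => (Ev.zero F as).congr fun a => ?_
    refine (Val.apps_tgt _ w a).trans ?_
    have h₁ := fun xs => hρ.zero _ (FSym.cur F rfl) xs
    have h₂ := fun i xs => hρ.zero _ (FSym.arg F rfl i) xs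
    refine (congrArg₂ (· + ·) (h₁ _) (tsum_congr fun x => congrArg (· * _) (h₂ x _))).trans ?_
    exact zero_add_tsum_zero_mul _
  | succ k ih =>
    refine rel_of_apps ⟨0, trivial, fun _ _ => rfl⟩ fun as w h =>
      (Ev.succ (ev_inst hG ih h (G.tL F) (hG F).1) (ev_inst hG ih h (G.tR F) (hG F).2)).congr
        fun a => ?_
    refine (Val.apps_tgt _ w a).trans ?_
    -- The equations of `F_0` and of the `F_i`, at exactly the argument tuples that occur in
    -- `Val.apps_tgt`.
    have h₁ := (hρ.succ k _ (FSym.cur F rfl)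
      (Val.argVals .full w fun _ z => (w _ z).tgt a)).trans (Expr.eval_rename _ _ _ _)
    have h₂ := fun i => (hρ.succ k _ (FSym.arg F rfl i)
      (Val.argVals .prime w fun _ z => (w _ z).fresh)).trans (Expr.eval_rename _ _ _ _)
    simp only [TVar.get_bound] at h₁ h₂
    have h₁ := h₁.trans (eval_choice F _ _ _ _)
    have h₂ := fun i => (h₂ i).trans (eval_choice F _ _ _ _)
    refine (congrArg₂ (· + ·) h₁ (tsum_congr fun x => congrArg (· * _) (h₂ x))).trans ?_
    exact linear_combination_tsum _ _ _ _ _ _ _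

/-- The value of `S t` at a target is `S_0 + S_1 · t_a`. Taking `t = Ω` isolates `S_0`, which is 0
because `S Ω` contains no target; taking `t` to be the target `0`, which stands for `e`, then leaves
`S_1`. -/
theorem ev_start (hG : G.EFree) (hS : G.ty G.start = .arr .o .o)
    {ρ : ℕ → ∀ τ, FSym G.ty τ → Sem τ} (hρ : (G.eqs hG).Approximates ρ) (k : ℕ) :
    ∃ f, G.Ev (.app (.nt G.start k hS) (.tgt 0)) f ∧
      f 0 = (show ℝ≥0∞ from ρ k .real (G.startSym hS)) := by
  have hrel : G.Rel (.nt G.start k hS) (Val.nt (ρ k) G.start hS) := by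
    have := rel_nt hG hρ k G.start
    generalize Ty.arr .o .o = σ at hS
    subst hS
    exact this
  have hΩ : G.Rel .Ω (⟨fun _ => (0 : ℝ≥0∞), nofun, (0 : ℝ≥0∞)⟩ : Val .o) :=
    ⟨⟨0, trivial, fun _ _ => rfl⟩, Ev.Ω⟩
  have htgt : G.Rel (.tgt 0) (⟨(Pi.single 0 1 : ℕ → ℝ≥0∞), nofun, (0 : ℝ≥0∞)⟩ : Val .o) :=
    ⟨⟨1, Nat.zero_lt_one, fun a ha => Pi.single_eq_of_ne (by omega) _⟩, Ev.tgt 0⟩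
  have h₀ : (show ℝ≥0∞ from ρ k (comp (.arr .o .o) .full) (.cur G.start hS)) +
      (show ℝ≥0∞ from ρ k .real (G.startSym hS)) * 0 = 0 :=
    Ev.eq_zero_of_below hG (hrel.app hΩ).2 (M := 0) ⟨trivial, trivial⟩ le_rfl
  refine ⟨_, (hrel.app htgt).2, ?_⟩
  change (show ℝ≥0∞ from ρ k (comp (.arr .o .o) .full) (.cur G.start hS)) +
      (show ℝ≥0∞ from ρ k .real (G.startSym hS)) * (Pi.single 0 1 : ℕ → ℝ≥0∞) 0 = _
  rw [mul_zero, add_zero] at h₀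
  rw [h₀, Pi.single_eq_same, mul_one, zero_add]

end PHORS

end HORS

end

theorem mainTheorem3 (G : HORS.PHORS) (n : ℕ) (hn : 0 < n) (hord : G.HasOrder n)
    (hS : G.ty G.start = .arr .o .o) (hG : G.EFree) :
    (G.eqs hG).HasOrder (n - 1) ∧
      ∃ ρ : ∀ τ, HORS.FSym G.ty τ → HORS.Sem τ,
        (G.eqs hG).IsLeastSolution ρ ∧
          G.prob (G.startTerm hS) = ρ .real (G.startSym hS) := by
  refine ⟨HORS.PHORS.eqs_hasOrder hG hord, ?_⟩
  obtain ⟨ρ, hρ, ρ', hρ', hsup⟩ := (G.eqs hG).exists_isLeastSolution fun τ f => by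
    obtain ⟨F, m, rfl⟩ := HORS.FSym.exists_eq_comp f
    exact HORS.comp_realValued _ _
  refine ⟨ρ, hρ, ?_⟩
  refine Eq.trans ?_ (hsup (G.startSym hS)).symm
  -- Both bounds come from the same term, `S` of depth `k` applied to the target `0`, which erases
  -- to `S e`.
  refine le_antisymm ((HORS.PHORS.prob_le_iSup_probLT _).trans (iSup_mono fun k => ?_))
    (iSup_le fun k => ?_)
  · obtain ⟨f, hf, hf0⟩ := HORS.PHORS.ev_start hG hS hρ' k
    exact (hf.probLT_le ⟨le_rfl, trivial⟩).trans hf0.le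
  · obtain ⟨f, hf, hf0⟩ := HORS.PHORS.ev_start hG hS hρ' k
    exact hf0.ge.trans hf.le_prob
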